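/- Let Minkowski space $M=\mathbb R^4$ carry the product $p\cdot x=p^0x^0-\vec p\cdot\vec x$, with $p^2=p\cdot p$, and for a (complex-valued) Schwartz function $J$ on $M$ put $\widehat J(p)=(2\pi)^{-2}\int e^{ip\cdot x}J(x)\,d^4x$. Let $\mathcal H$ be the bosonic Fock space of the positive-energy vacuum representation of the free massless scalar field, i.e. the bosonic Fock space over the single-particle Hilbert space $\mathcal H_1$ obtained by completing the Schwartz functions with respect to $$(J_1,J_2)=\frac1{(2\pi)^3}\int\theta(p^0)\,\delta(p^2)\,\overline{\widehat J_1(p)}\,\widehat J_2(p)\,d^4p ,$$ with creation and annihilation operators $a^*(J)$, $a(J)$, vacuum vector $\Omega$, and Weyl operators $W(J)=e^{-i(a(J)+a^*(J))}$. Let $P$ be the energy-momentum operators on $\mathcal H$, $U(x)=e^{ix\cdot P}$ the spacetime translations, $E(\cdot)$ the joint spectral measure of $P$, and for $\mu\ge 0$ let $$E_\mu=E\big(\{p : 0\le p^2\le\mu^2,\ p^0\ge 0\}\big).$$ (i) For every Schwartz function $J$ there is a constant $C$ with $\|(E_\mu-E_0)W(J)\Omega\|\le C\mu$ for all $\mu\ge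 0$; in particular $\|(E_\mu-E_0)W(J)\Omega\|=O(\mu)$. (ii) For all Schwartz functions $J$ and $\chi$ on $M$ the smeared Weyl operator $B=W(J)(\chi)=\int_M \chi(x)\,U(x)W(J)U(-x)\,d^4x$ (strong integral) is smooth, i.e. $x\mapsto U(x)BU(-x)$ is infinitely differentiable in operator norm; there is a constant $C$ with $\|(E_\mu-E_0)B\Omega\|\le C\mu$ for all $\mu\ge0$; and $B$ fulfils the spectral condition: for some $\varepsilon>0$ $$\int_0^\varepsilon\|(E_\mu-E_0)B\Omega\|\,\frac{d\mu}{\mu}<\infty .$$ -/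

import Mathlib

open MeasureTheory Filter Topology
open scoped ENNReal SchwartzMap ContDiff InnerProductSpace
noncomputable section
namespace FreeField
set_option linter.unusedSectionVars false
section Fock
variable {V : Type*} [MeasurableSpace V] (ν : Measure V) [SigmaFinite ν]

/-- Square-integrable functions of `n` particle variables (not yet symmetrised). -/
abbrev LTwo (n : ℕ) : Type _ := Lp ℂ 2 (Measure.pi fun _ : Fin n => ν)

theorem measurePreserving_perm {n : ℕ} (σ : Equiv.Perm (Fin n)) :
    MeasurePreserving (fun (p : Fin n → V) i => p (σ i))
      (Measure.pi fun _ => ν) (Measure.pi fun _ => ν) := by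
  have h := measurePreserving_piCongrLeft (fun _ : Fin n => ν) σ⁻¹
  convert h using 1
  ext p i
  have := MeasurableEquiv.coe_piCongrLeft (π := fun _ : Fin n => V) (f := σ⁻¹)
  rw [this]
  have h2 := Equiv.piCongrLeft_apply_apply (fun _ : Fin n => V) σ⁻¹ p (σ i)
  simpa using h2.symm

/-- The action `ψ ↦ ψ(p_{σ 0}, …, p_{σ (n-1)})` of a permutation. -/
def permOp {n : ℕ} (σ : Equiv.Perm (Fin n)) : LTwo ν n →ₗᵢ[ℂ] LTwo ν n :=
  Lp.compMeasurePreservingₗᵢ ℂ _ (measurePreserving_perm ν σ)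

theorem permOp_ae {n : ℕ} (σ : Equiv.Perm (Fin n)) (ψ : LTwo ν n) :
    permOp ν σ ψ =ᵐ[Measure.pi fun _ => ν] fun p => ψ (fun i => p (σ i)) :=
  Lp.coeFn_compMeasurePreserving ψ (measurePreserving_perm ν σ)

/-- The closed subspace of permutation-symmetric (bosonic) `n`-particle wave functions. -/
def symmetricSubspace (n : ℕ) : Submodule ℂ (LTwo ν n) where
  carrier := {ψ | ∀ σ, permOp ν σ ψ = ψ}
  add_mem' := fun ha hb σ => by rw [map_add, ha σ, hb σ]
  zero_mem' := fun σ => map_zero _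
  smul_mem' := fun c x hx σ => by rw [map_smul, hx σ]

theorem isClosed_symmetricSubspace (n : ℕ) :
    IsClosed (symmetricSubspace ν n : Set (LTwo ν n)) := by
  have : (symmetricSubspace ν n : Set (LTwo ν n)) = ⋂ σ, {ψ | permOp ν σ ψ = ψ} := by
    ext; simp [symmetricSubspace]
  rw [this]
  exact isClosed_iInter fun σ => isClosed_eq (permOp ν σ).continuous continuous_id

/-- The bosonic `n`-particle Hilbert space over the one-particle space `L²(V, ν)`. -/
abbrev NParticle (n : ℕ) : Type _ := symmetricSubspace ν n

instance (n : ℕ) : CompleteSpace (NParticle ν n) :=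
  (isClosed_symmetricSubspace ν n).completeSpace_coe

theorem measurePreserving_split {n : ℕ} (j : Fin (n + 1)) :
    MeasurePreserving (fun p : Fin (n + 1) → V => (p j, j.removeNth p))
      (Measure.pi fun _ => ν) (ν.prod (Measure.pi fun _ => ν)) :=
  measurePreserving_piFinSuccAbove (fun _ : Fin (n + 1) => ν) j

theorem lintegral_insert {n : ℕ} (j : Fin (n + 1)) {f : V → ℂ} {g : (Fin n → V) → ℂ}
    (hf : AEStronglyMeasurable f ν) (hg : AEStronglyMeasurable g (Measure.pi fun _ => ν)) :
    AEStronglyMeasurable (fun p : Fin (n + 1) → V => f (p j) * g (j.removeNth p))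
        (Measure.pi fun _ => ν) ∧
      eLpNorm (fun p : Fin (n + 1) → V => f (p j) * g (j.removeNth p)) 2 (Measure.pi fun _ => ν)
        = eLpNorm f 2 ν * eLpNorm g 2 (Measure.pi fun _ => ν) := by
  have hm : AEStronglyMeasurable (fun x : V × (Fin n → V) => f x.1 * g x.2)
      (ν.prod (Measure.pi fun _ => ν)) := hf.comp_fst.mul hg.comp_snd
  have mp := measurePreserving_split ν j
  refine ⟨hm.comp_measurePreserving mp, ?_⟩
  have h1 := eLpNorm_comp_measurePreserving (p := 2) hm mp
  refine Eq.trans h1 ?_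
  simp only [eLpNorm_eq_lintegral_rpow_enorm_toReal (p := 2) (by norm_num) (by norm_num), enorm_mul]
  rw [← ENNReal.mul_rpow_of_nonneg _ _ (by norm_num)]
  simp only [ENNReal.mul_rpow_of_nonneg _ _ (show (0:ℝ) ≤ (2:ℝ≥0∞).toReal by norm_num)]
  congr 1
  exact lintegral_prod_mul (f := fun x => ‖f x‖ₑ ^ (2:ℝ≥0∞).toReal)
    (g := fun x => ‖g x‖ₑ ^ (2:ℝ≥0∞).toReal) (hf.enorm.pow_const _) (hg.enorm.pow_const _)

theorem memLp_insert {n : ℕ} (j : Fin (n + 1)) (f : Lp ℂ 2 ν) (ψ : LTwo ν n) :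
    MemLp (fun p : Fin (n + 1) → V => f (p j) * ψ (j.removeNth p)) 2 (Measure.pi fun _ => ν) := by
  obtain ⟨h1, h2⟩ := lintegral_insert ν j (Lp.aestronglyMeasurable f) (Lp.aestronglyMeasurable ψ)
  exact ⟨h1, h2 ▸ ENNReal.mul_lt_top (Lp.memLp f).2 (Lp.memLp ψ).2⟩

/-- `ψ ↦ f(p_j) ψ(p_0, …, p̂_j, …, p_n)`. -/
def insertOp {n : ℕ} (f : Lp ℂ 2 ν) (j : Fin (n + 1)) : LTwo ν n →L[ℂ] LTwo ν (n + 1) :=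
  LinearMap.mkContinuous
    { toFun := fun ψ => (memLp_insert ν j f ψ).toLp
      map_add' := fun ψ φ => by
        rw [← MemLp.toLp_add, MemLp.toLp_eq_toLp_iff]
        have := (Measure.quasiMeasurePreserving_snd.comp
          (measurePreserving_split ν j).quasiMeasurePreserving).ae_eq (Lp.coeFn_add ψ φ)
        filter_upwards [this] with p hp
        simp only [Function.comp_apply, Pi.add_apply] at hp ⊢
        rw [hp]; ring
      map_smul' := fun c ψ => by
        rw [RingHom.id_apply, ← MemLp.toLp_const_smul, MemLp.toLp_eq_toLp_iff]
        have := (Measure.quasiMeasurePreserving_snd.comp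
          (measurePreserving_split ν j).quasiMeasurePreserving).ae_eq (Lp.coeFn_smul c ψ)
        filter_upwards [this] with p hp
        simp only [Function.comp_apply, Pi.smul_apply, smul_eq_mul] at hp ⊢
        rw [hp]; ring }
    ‖f‖ fun ψ => by
      simp only [LinearMap.coe_mk, AddHom.coe_mk, Lp.norm_toLp]
      rw [(lintegral_insert ν j (Lp.aestronglyMeasurable f) (Lp.aestronglyMeasurable ψ)).2,
        ENNReal.toReal_mul]
      rfl

theorem insertOp_ae {n : ℕ} (f : Lp ℂ 2 ν) (j : Fin (n + 1)) (ψ : LTwo ν n) :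
    insertOp ν f j ψ =ᵐ[Measure.pi fun _ => ν] fun p => f (p j) * ψ (j.removeNth p) :=
  (memLp_insert ν j f ψ).coeFn_toLp

theorem norm_insertOp_le {n : ℕ} (f : Lp ℂ 2 ν) (j : Fin (n + 1)) : ‖insertOp ν f j‖ ≤ ‖f‖ :=
  LinearMap.mkContinuous_norm_le _ (norm_nonneg f) _

theorem permOp_insertOp {n : ℕ} (f : Lp ℂ 2 ν) (j : Fin (n + 1)) (σ : Equiv.Perm (Fin (n + 1)))
    (ψ : NParticle ν n) :
    permOp ν σ (insertOp ν f j ψ.1) = insertOp ν f (σ j) ψ.1 := by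
  let τ : Equiv.Perm (Fin n) := (finSuccAboveEquiv j).trans
    ((σ.subtypeEquiv (fun a => by simp)).trans (finSuccAboveEquiv (σ j)).symm)
  have hτ : ∀ i, (σ j).succAbove (τ i) = σ (j.succAbove i) := fun i => by
    have := (finSuccAboveEquiv (σ j)).apply_symm_apply
      ((σ.subtypeEquiv (p := fun a => a ≠ j) (q := fun a => a ≠ σ j) (fun a => by simp))
        (finSuccAboveEquiv j i))
    exact congrArg Subtype.val this
  conv_rhs => rw [← ψ.2 τ]
  apply Lp.ext
  have h1 := permOp_ae ν σ (insertOp ν f j ψ.1)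
  have h2 := (measurePreserving_perm ν σ).quasiMeasurePreserving.ae_eq (insertOp_ae ν f j ψ.1)
  have h3 := insertOp_ae ν f (σ j) (permOp ν τ ψ.1)
  have h4 := (Measure.quasiMeasurePreserving_snd.comp
          (measurePreserving_split ν (σ j)).quasiMeasurePreserving).ae_eq (permOp_ae ν τ ψ.1)
  filter_upwards [h1, h2, h3, h4] with p h1 h2 h3 h4
  simp only [Function.comp_apply] at h2 h4
  rw [h1, h2, h3, h4]
  congr 2
  funext i
  simp [Fin.removeNth, hτ]

/-- The creation operator from `n` to `n + 1` particles:
`(a*(f) ψ)(p_0, …, p_n) = (n + 1)^{-1/2} ∑_j f(p_j) ψ(p_0, …, p̂_j, …, p_n)`. -/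
def creation (f : Lp ℂ 2 ν) (n : ℕ) : NParticle ν n →L[ℂ] NParticle ν (n + 1) :=
  (((Real.sqrt (n + 1) : ℂ)⁻¹ • ∑ j : Fin (n + 1), insertOp ν f j).comp
    (symmetricSubspace ν n).subtypeL).codRestrict (symmetricSubspace ν (n + 1)) fun ψ σ => by
      simp only [ContinuousLinearMap.comp_apply, _root_.smul_apply,
        _root_.sum_apply, Submodule.subtypeL_apply, map_smul, map_sum,
        permOp_insertOp]
      rw [Equiv.sum_comp σ fun j => insertOp ν f j ψ.1]

theorem norm_creation_le (f : Lp ℂ 2 ν) (n : ℕ) :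
    ‖creation ν f n‖ ≤ ‖f‖ * Real.sqrt (n + 1) := by
  refine ContinuousLinearMap.opNorm_le_bound _ (by positivity) fun ψ => ?_
  have h0 : (0 : ℝ) < n + 1 := by positivity
  have h1 : ‖∑ j : Fin (n + 1), insertOp ν f j ψ.1‖ ≤ (n + 1) * (‖f‖ * ‖ψ‖) := by
    refine (norm_sum_le _ _).trans ((Finset.sum_le_card_nsmul _ _ (‖f‖ * ‖ψ‖) fun j _ => ?_).trans ?_)
    · exact (insertOp ν f j).le_of_opNorm_le (norm_insertOp_le ν f j) ψ.1
    · simp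
  have h2 : ‖creation ν f n ψ‖ = (Real.sqrt (n + 1))⁻¹ * ‖∑ j : Fin (n + 1), insertOp ν f j ψ.1‖ := by
    have : ((creation ν f n ψ : NParticle ν (n + 1)) : LTwo ν (n + 1)) =
      (Real.sqrt (n + 1) : ℂ)⁻¹ • ∑ j : Fin (n + 1), insertOp ν f j ψ.1 := by
        simp [creation]
    rw [← Submodule.norm_coe, this, norm_smul, norm_inv, Complex.norm_real, Real.norm_of_nonneg (Real.sqrt_nonneg _)]
  rw [h2]
  calc _ ≤ (Real.sqrt (n + 1))⁻¹ * ((n + 1) * (‖f‖ * ‖ψ‖)) := by gcongr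
    _ = ((Real.sqrt (n + 1))⁻¹ * (n + 1)) * (‖f‖ * ‖ψ‖) := by ring
    _ = ‖f‖ * Real.sqrt (n + 1) * ‖ψ‖ := by
      rw [inv_mul_eq_div, Real.div_sqrt]; ring

end Fock
/-- Summation along antidiagonals. -/
theorem tsum_eq_tsum_antidiagonal {F : ℕ × ℕ → ℂ} (hF : Summable F) :
    ∑' x, F x = ∑' n, ∑ x ∈ Finset.HasAntidiagonal.antidiagonal n, F x := by
  have hsig := (Finset.HasAntidiagonal.sigmaAntidiagonalEquivProd (A := ℕ)).summable_iff.mpr hF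
  rw [← (Finset.HasAntidiagonal.sigmaAntidiagonalEquivProd (A := ℕ)).tsum_eq F]
  refine (Summable.tsum_sigma' (fun n => (hasSum_fintype _).summable) hsig).trans
    (tsum_congr fun n => ?_)
  rw [tsum_fintype]
  exact Finset.sum_coe_sort (Finset.HasAntidiagonal.antidiagonal n) F

section FieldOp
variable {H : ℕ → Type*} [∀ n, NormedAddCommGroup (H n)] [∀ n, InnerProductSpace ℂ (H n)]
  [∀ n, CompleteSpace (H n)]

/-- The inclusion of the finite-particle vectors (the algebraic direct sum) into the Hilbert sum. -/
def incl (H : ℕ → Type*) [∀ n, NormedAddCommGroup (H n)] [∀ n, InnerProductSpace ℂ (H n)] :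
    (DirectSum ℕ H) →ₗ[ℂ] lp H 2 :=
  DirectSum.toModule ℂ ℕ _ fun n => lp.lsingle 2 n

/-- The creation operator on finite-particle vectors, given by its components
`c n` from `n` to `n + 1` particles. -/
def raiseOp (c : ∀ n, H n →L[ℂ] H (n + 1)) : (DirectSum ℕ H) →ₗ[ℂ] (DirectSum ℕ H) :=
  DirectSum.toModule ℂ ℕ _ fun n => (DirectSum.lof ℂ ℕ H (n + 1)).comp (c n).toLinearMap

/-- The annihilation operator on finite-particle vectors: the adjoint of the creation operator,
with components `(c m)*` from `m + 1` to `m` particles; it kills the `0`-particle space. -/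
def lowerOp (c : ∀ n, H n →L[ℂ] H (n + 1)) : (DirectSum ℕ H) →ₗ[ℂ] (DirectSum ℕ H) :=
  DirectSum.toModule ℂ ℕ _ fun n => match n with
    | 0 => 0
    | m + 1 => (DirectSum.lof ℂ ℕ H m).comp (ContinuousLinearMap.adjoint (c m)).toLinearMap

/-- The field operator `a + a*` on finite-particle vectors. -/
def fieldOp (c : ∀ n, H n →L[ℂ] H (n + 1)) : (DirectSum ℕ H) →ₗ[ℂ] (DirectSum ℕ H) :=
  lowerOp c + raiseOp c

/-- The `k`-th term `(-i)^k / k! (a + a*)^k Ψ` of the exponential series on finite-particle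
vectors. -/
def expTerm (c : ∀ n, H n →L[ℂ] H (n + 1)) (k : ℕ) : (DirectSum ℕ H) →ₗ[ℂ] lp H 2 :=
  ((-Complex.I) ^ k / (k.factorial : ℂ)) • (incl H).comp (fieldOp c ^ k)

/-- An auxiliary constant that bounds `(a + a*)^k` on vectors with at most `n` particles. -/
def growth (C : ℝ) (n k : ℕ) : ℝ := ∏ i ∈ Finset.range k, (2 * C * Real.sqrt (n + i + 1))

theorem incl_lof (n : ℕ) (x : H n) : incl H (DirectSum.lof ℂ ℕ H n x) = lp.single 2 n x := by
  simp [incl]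

theorem norm_fieldOp_pow {c : ∀ n, H n →L[ℂ] H (n + 1)} {C : ℝ} (hC : 0 ≤ C)
    (hc : ∀ n, ‖c n‖ ≤ C * Real.sqrt (n + 1)) (k : ℕ) :
    ∀ (N n : ℕ), n ≤ N → ∀ x : H n,
      ‖incl H ((fieldOp c ^ k) (DirectSum.lof ℂ ℕ H n x))‖ ≤ growth C N k * ‖x‖ := by
  induction k with
  | zero =>
    intro N n _ x
    simp [growth, incl_lof]
  | succ k ih =>
    intro N n hn x
    have hg : ∀ (N : ℕ) (k : ℕ), 0 ≤ growth C N k := fun N k =>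
      Finset.prod_nonneg fun i _ => by positivity
    have hgs : growth C N (k + 1) = growth C (N + 1) k * (2 * C * Real.sqrt (N + 1)) := by
      rw [growth, Finset.prod_range_succ', growth]
      simp only [Nat.cast_add, Nat.cast_one, Nat.cast_zero, add_zero]
      congr 1
      exact Finset.prod_congr rfl fun i _ => by ring_nf
    have hsq : ∀ m : ℕ, m ≤ N → C * Real.sqrt (m + 1) ≤ C * Real.sqrt (N + 1) := fun m hm => by
      gcongr
    have hr : raiseOp c (DirectSum.lof ℂ ℕ H n x) = DirectSum.lof ℂ ℕ H (n + 1) (c n x) := by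
      simp [raiseOp]
    have h1 : ‖incl H ((fieldOp c ^ k) (raiseOp c (DirectSum.lof ℂ ℕ H n x)))‖
        ≤ growth C (N + 1) k * (C * Real.sqrt (N + 1) * ‖x‖) := by
      rw [hr]
      refine (ih (N + 1) (n + 1) (by omega) _).trans ?_
      exact mul_le_mul_of_nonneg_left
        ((c n).le_of_opNorm_le ((hc n).trans (hsq n hn)) x) (hg _ _)
    have h2 : ‖incl H ((fieldOp c ^ k) (lowerOp c (DirectSum.lof ℂ ℕ H n x)))‖
        ≤ growth C (N + 1) k * (C * Real.sqrt (N + 1) * ‖x‖) := by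
      cases n with
      | zero =>
        have : lowerOp c (DirectSum.lof ℂ ℕ H 0 x) = 0 := by simp [lowerOp]
        rw [this]
        simp only [map_zero, norm_zero]
        have := hg (N + 1) k
        positivity
      | succ m =>
        have : lowerOp c (DirectSum.lof ℂ ℕ H (m + 1) x) =
          DirectSum.lof ℂ ℕ H m (ContinuousLinearMap.adjoint (c m) x) := by simp [lowerOp]
        rw [this]
        refine (ih (N + 1) m (by omega) _).trans ?_
        refine mul_le_mul_of_nonneg_left
          ((ContinuousLinearMap.adjoint (c m)).le_of_opNorm_le ?_ x) (hg _ _)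
        rw [LinearIsometryEquiv.norm_map]
        exact (hc m).trans (hsq m (by omega))
    rw [pow_succ, Module.End.mul_apply, fieldOp, LinearMap.add_apply, map_add, map_add]
    refine (norm_add_le _ _).trans ((add_le_add h2 h1).trans_eq ?_)
    rw [hgs]; ring

theorem summable_growth {C : ℝ} (hC : 0 ≤ C) (n : ℕ) :
    Summable fun k : ℕ => growth C n k / (k.factorial : ℝ) := by
  rcases hC.eq_or_lt with rfl | hC
  · refine summable_of_ne_finset_zero (s := {0}) fun k hk => ?_
    have : k ≠ 0 := by simpa using hk
    simp [growth, this]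
  have hpos : ∀ k, 0 < growth C n k := fun k => Finset.prod_pos fun i _ => by positivity
  refine summable_of_ratio_test_tendsto_lt_one (l := 0) zero_lt_one
    (Eventually.of_forall fun k => (div_pos (hpos k) (by positivity)).ne') ?_
  have heq : ∀ k : ℕ, ‖growth C n (k + 1) / ((k + 1).factorial : ℝ)‖ /
      ‖growth C n k / (k.factorial : ℝ)‖ = 2 * C * (Real.sqrt (n + k + 1) / (k + 1)) := fun k => by
    have h := (hpos k).ne'
    rw [Real.norm_of_nonneg (div_pos (hpos _) (by positivity)).le,
      Real.norm_of_nonneg (div_pos (hpos _) (by positivity)).le, Nat.factorial_succ]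
    have h1 : growth C n (k + 1) = growth C n k * (2 * C * Real.sqrt (n + k + 1)) :=
      Finset.prod_range_succ _ _
    rw [h1]
    have : (k.factorial : ℝ) ≠ 0 := by positivity
    push_cast
    field_simp
  simp only [heq]
  rw [show (0 : ℝ) = 2 * C * 0 by ring]
  refine Tendsto.const_mul _ ?_
  have hlim : Tendsto (fun k : ℕ => Real.sqrt (n + 1) * (Real.sqrt (k + 1))⁻¹) atTop (𝓝 0) := by
    rw [show (0 : ℝ) = Real.sqrt (n + 1) * 0 by ring]
    refine Tendsto.const_mul _ (Tendsto.inv_tendsto_atTop ?_)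
    exact Real.tendsto_sqrt_atTop.comp
      (tendsto_natCast_atTop_atTop.atTop_add tendsto_const_nhds)
  refine squeeze_zero (fun k => by positivity) (fun k => ?_) hlim
  have h1 : Real.sqrt (n + k + 1) ≤ Real.sqrt (n + 1) * Real.sqrt (k + 1) := by
    rw [← Real.sqrt_mul (by positivity)]
    refine Real.sqrt_le_sqrt ?_
    nlinarith [mul_nonneg (Nat.cast_nonneg (α := ℝ) n) (Nat.cast_nonneg (α := ℝ) k)]
  calc _ ≤ Real.sqrt (n + 1) * Real.sqrt (k + 1) / (k + 1) := by gcongr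
    _ = _ := by rw [mul_div_assoc, Real.sqrt_div_self]

theorem summable_norm_expTerm {c : ∀ n, H n →L[ℂ] H (n + 1)} {C : ℝ} (hC : 0 ≤ C)
    (hc : ∀ n, ‖c n‖ ≤ C * Real.sqrt (n + 1)) (Ψ : DirectSum ℕ H) :
    Summable fun k => ‖expTerm c k Ψ‖ := by
  induction Ψ using DirectSum.induction_on with
  | zero => simp [summable_zero]
  | of n x =>
    refine Summable.of_nonneg_of_le (fun _ => norm_nonneg _) (fun k => ?_)
      ((summable_growth hC n).mul_right ‖x‖)
    have := norm_fieldOp_pow hC hc k n n le_rfl x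
    simp only [expTerm, LinearMap.smul_apply, LinearMap.comp_apply, norm_smul, norm_div, norm_pow,
      norm_neg, Complex.norm_I, one_pow, Complex.norm_natCast]
    rw [div_mul_eq_mul_div, div_mul_eq_mul_div, one_mul]
    exact div_le_div_of_nonneg_right this (by positivity)
  | add Ψ Φ h1 h2 =>
    refine Summable.of_nonneg_of_le (fun _ => norm_nonneg _) (fun k => ?_) (h1.add h2)
    rw [map_add]; exact norm_add_le _ _

/-- `exp(-i (a + a*)) Ψ`, through its absolutely convergent power series, for finite-particle
vectors `Ψ` (they are analytic vectors of `a + a*`). -/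
def expSeries (c : ∀ n, H n →L[ℂ] H (n + 1)) (C : ℝ) (hC : 0 ≤ C)
    (hc : ∀ n, ‖c n‖ ≤ C * Real.sqrt (n + 1)) : (DirectSum ℕ H) →ₗ[ℂ] lp H 2 where
  toFun Ψ := ∑' k, expTerm c k Ψ
  map_add' Ψ Φ := by
    simp only [map_add]
    exact (summable_norm_expTerm hC hc Ψ).of_norm.tsum_add (summable_norm_expTerm hC hc Φ).of_norm
  map_smul' a Ψ := by
    simp only [map_smul, RingHom.id_apply]
    exact (summable_norm_expTerm hC hc Ψ).of_norm.tsum_const_smul a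

theorem inner_fieldOp (c : ∀ n, H n →L[ℂ] H (n + 1)) (Ψ Φ : DirectSum ℕ H) :
    ⟪incl H (fieldOp c Ψ), incl H Φ⟫_ℂ = ⟪incl H Ψ, incl H (fieldOp c Φ)⟫_ℂ := by
  have key : ∀ Ψ Φ : DirectSum ℕ H,
      ⟪incl H (raiseOp c Ψ), incl H Φ⟫_ℂ = ⟪incl H Ψ, incl H (lowerOp c Φ)⟫_ℂ := by
    intro Ψ Φ
    induction Ψ using DirectSum.induction_on with
    | zero => simp
    | add Ψ₁ Ψ₂ h1 h2 => simp only [map_add, inner_add_left, h1, h2]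
    | of n x =>
      induction Φ using DirectSum.induction_on with
      | zero => simp
      | add Ψ₁ Ψ₂ h1 h2 => simp only [map_add, inner_add_right, h1, h2]
      | of m y =>
        rw [← DirectSum.lof_eq_of ℂ, ← DirectSum.lof_eq_of ℂ]
        have hr : raiseOp c (DirectSum.lof ℂ ℕ H n x) = DirectSum.lof ℂ ℕ H (n + 1) (c n x) := by
          simp [raiseOp]
        rw [hr, incl_lof, incl_lof, incl_lof, lp.inner_single_left, lp.inner_single_left]
        cases m with
        | zero =>
          have : lowerOp c (DirectSum.lof ℂ ℕ H 0 y) = 0 := by simp [lowerOp]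
          rw [this, lp.single_apply_ne _ _ _ (by omega)]
          simp
        | succ m =>
          have : lowerOp c (DirectSum.lof ℂ ℕ H (m + 1) y) =
            DirectSum.lof ℂ ℕ H m (ContinuousLinearMap.adjoint (c m) y) := by simp [lowerOp]
          rw [this, incl_lof]
          by_cases h : n = m
          · subst h
            rw [lp.single_apply_self, lp.single_apply_self, ContinuousLinearMap.adjoint_inner_right]
          · rw [lp.single_apply_ne _ _ _ (by omega), lp.single_apply_ne _ _ _ h]
            simp
  have key' : ⟪incl H (lowerOp c Ψ), incl H Φ⟫_ℂ = ⟪incl H Ψ, incl H (raiseOp c Φ)⟫_ℂ := by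
    rw [← inner_conj_symm, ← key, inner_conj_symm]
  simp only [fieldOp, LinearMap.add_apply, map_add, inner_add_left, inner_add_right, key, key']
  ring

theorem inner_fieldOp_pow (c : ∀ n, H n →L[ℂ] H (n + 1)) (k : ℕ) (Ψ Φ : DirectSum ℕ H) :
    ⟪incl H ((fieldOp c ^ k) Ψ), incl H Φ⟫_ℂ = ⟪incl H Ψ, incl H ((fieldOp c ^ k) Φ)⟫_ℂ := by
  induction k generalizing Ψ Φ with
  | zero => simp
  | succ k ih =>
    rw [pow_succ', Module.End.mul_apply, inner_fieldOp, ih, ← Module.End.mul_apply,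
      ← pow_succ, pow_succ']

theorem norm_expSeries (c : ∀ n, H n →L[ℂ] H (n + 1)) (C : ℝ) (hC : 0 ≤ C)
    (hc : ∀ n, ‖c n‖ ≤ C * Real.sqrt (n + 1)) (Ψ : DirectSum ℕ H) :
    ‖expSeries c C hC hc Ψ‖ = ‖incl H Ψ‖ := by
  have hs := summable_norm_expTerm hC hc Ψ
  have hprod : Summable fun x : ℕ × ℕ => ⟪expTerm c x.1 Ψ, expTerm c x.2 Ψ⟫_ℂ := by
    refine Summable.of_norm_bounded (hs.mul_of_nonneg hs (fun _ => norm_nonneg _)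
      fun _ => norm_nonneg _) fun x => norm_inner_le_norm _ _
  have h1 : ⟪expSeries c C hC hc Ψ, expSeries c C hC hc Ψ⟫_ℂ =
      ∑' x : ℕ × ℕ, ⟪expTerm c x.1 Ψ, expTerm c x.2 Ψ⟫_ℂ := by
    rw [hprod.tsum_prod]
    have e : expSeries c C hC hc Ψ = ∑' k, expTerm c k Ψ := rfl
    have e2 : ∀ v : lp H 2, ⟪v, ∑' k, expTerm c k Ψ⟫_ℂ = ∑' k, ⟪v, expTerm c k Ψ⟫_ℂ := fun v =>
      ((innerSL ℂ v).map_tsum hs.of_norm)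
    rw [e, ← inner_conj_symm, e2, Complex.conj_tsum]
    refine tsum_congr fun k => ?_
    rw [inner_conj_symm, e2]
  have h2 : ∑' x : ℕ × ℕ, ⟪expTerm c x.1 Ψ, expTerm c x.2 Ψ⟫_ℂ = ⟪incl H Ψ, incl H Ψ⟫_ℂ := by
    rw [tsum_eq_tsum_antidiagonal hprod]
    have : ∀ n : ℕ, ∑ x ∈ Finset.HasAntidiagonal.antidiagonal n, ⟪expTerm c x.1 Ψ, expTerm c x.2 Ψ⟫_ℂ =
        ((Complex.I + -Complex.I) ^ n / (n.factorial : ℂ)) *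
          ⟪incl H Ψ, incl H ((fieldOp c ^ n) Ψ)⟫_ℂ := fun n => by
      rw [(Commute.all _ _).add_pow', Finset.sum_div, Finset.sum_mul]
      refine Finset.sum_congr rfl fun x hx => ?_
      obtain ⟨i, j⟩ := x
      rw [Finset.HasAntidiagonal.mem_antidiagonal] at hx
      simp only at hx ⊢
      subst hx
      simp only [expTerm, LinearMap.smul_apply, LinearMap.comp_apply, inner_smul_left,
        inner_smul_right, inner_fieldOp_pow, ← Module.End.mul_apply, ← pow_add, map_div₀, map_pow,
        map_neg, Complex.conj_I, neg_neg, map_natCast, nsmul_eq_mul]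
      have hch : (((i + j).choose i : ℕ) : ℂ) =
          ((i + j).factorial : ℂ) / ((i.factorial : ℂ) * (j.factorial : ℂ)) := by
        rw [Nat.cast_add_choose]
      have a1 : (i.factorial : ℂ) ≠ 0 := by exact_mod_cast i.factorial_ne_zero
      have a2 : (j.factorial : ℂ) ≠ 0 := by exact_mod_cast j.factorial_ne_zero
      have a3 : ((i + j).factorial : ℂ) ≠ 0 := by exact_mod_cast (i + j).factorial_ne_zero
      rw [hch]
      field_simp
    rw [tsum_congr this, tsum_eq_single 0 fun n hn => by simp [hn]]
    simp
  have h3 := h1.trans h2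
  rw [inner_self_eq_norm_sq_to_K, inner_self_eq_norm_sq_to_K] at h3
  have h4 : ‖expSeries c C hC hc Ψ‖ ^ 2 = ‖incl H Ψ‖ ^ 2 := by exact_mod_cast h3
  exact (pow_left_inj₀ (norm_nonneg _) (norm_nonneg _) two_ne_zero).mp h4

theorem denseRange_incl : DenseRange (incl H) := by
  intro Ψ
  refine mem_closure_of_tendsto (lp.hasSum_single (by norm_num) Ψ) (Eventually.of_forall fun s => ?_)
  exact ⟨∑ i ∈ s, DirectSum.lof ℂ ℕ H i (Ψ i), by simp [incl_lof]⟩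

/-- The operator `exp(-i (a + a*))`: the continuous extension of the isometric exponential series
on the dense space of finite-particle vectors to the whole space. -/
def weylOp (c : ∀ n, H n →L[ℂ] H (n + 1)) (C : ℝ) (hC : 0 ≤ C)
    (hc : ∀ n, ‖c n‖ ≤ C * Real.sqrt (n + 1)) : lp H 2 →L[ℂ] lp H 2 :=
  (expSeries c C hC hc).extendOfNorm (incl H)

/-- On finite-particle vectors the Weyl operator is the sum of the exponential series. -/
theorem weylOp_incl (c : ∀ n, H n →L[ℂ] H (n + 1)) (C : ℝ) (hC : 0 ≤ C)
    (hc : ∀ n, ‖c n‖ ≤ C * Real.sqrt (n + 1)) (Ψ : DirectSum ℕ H) :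
    HasSum (fun k => expTerm c k Ψ) (weylOp c C hC hc (incl H Ψ)) := by
  have : weylOp c C hC hc (incl H Ψ) = ∑' k, expTerm c k Ψ :=
    LinearMap.extendOfNorm_eq denseRange_incl
      ⟨1, fun Ψ => by rw [one_mul, norm_expSeries]⟩ Ψ
  rw [this]
  exact (summable_norm_expTerm hC hc Ψ).of_norm.hasSum

/-- The operator that acts as `T n` on the `n`-th summand of a Hilbert sum. -/
def diagOp (T : ∀ n, H n →L[ℂ] H n) (hT : ∀ n, ‖T n‖ ≤ 1) : lp H 2 →L[ℂ] lp H 2 :=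
  LinearMap.mkContinuous
    { toFun := fun Ψ => ⟨fun n => T n (Ψ n), (lp.memℓp Ψ).mono' fun n => by
        simpa using (T n).le_of_opNorm_le (hT n) (Ψ n)⟩
      map_add' := fun Ψ Φ => by ext n; exact map_add (T n) (Ψ n) (Φ n)
      map_smul' := fun a Ψ => by ext n; exact map_smul (T n) a (Ψ n) }
    1 fun Ψ => by
      rw [one_mul]
      refine lp.norm_le_of_forall_sum_le (by norm_num) (norm_nonneg _) fun s => ?_
      refine le_trans (Finset.sum_le_sum fun n _ => ?_)
        (lp.sum_rpow_le_norm_rpow (by norm_num) Ψ s)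
      exact Real.rpow_le_rpow (norm_nonneg _)
        (by simpa using (T n).le_of_opNorm_le (hT n) (Ψ n)) (by norm_num)

theorem norm_diagOp_le (T : ∀ n, H n →L[ℂ] H n) (hT : ∀ n, ‖T n‖ ≤ 1) : ‖diagOp T hT‖ ≤ 1 :=
  LinearMap.mkContinuous_norm_le _ zero_le_one _

theorem diagOp_apply (T : ∀ n, H n →L[ℂ] H n) (hT : ∀ n, ‖T n‖ ≤ 1) (Ψ : lp H 2) (n : ℕ) :
    diagOp T hT Ψ n = T n (Ψ n) := rfl

end FieldOp

section Momentum
variable {V : Type*} [MeasurableSpace V] (ν : Measure V) [SigmaFinite ν]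

theorem memLp_mul {n : ℕ} {g : (Fin n → V) → ℂ} (hg : Measurable g) (hb : ∀ p, ‖g p‖ ≤ 1)
    (ψ : LTwo ν n) : MemLp (fun p => g p * ψ p) 2 (Measure.pi fun _ => ν) :=
  (Lp.memLp ψ).of_le (hg.aestronglyMeasurable.mul (Lp.aestronglyMeasurable ψ))
    (Eventually.of_forall fun p => by
      rw [norm_mul]; exact mul_le_of_le_one_left (norm_nonneg _) (hb p))

/-- Multiplication by a measurable function bounded by `1`. -/
def mulOp {n : ℕ} (g : (Fin n → V) → ℂ) (hg : Measurable g) (hb : ∀ p, ‖g p‖ ≤ 1) :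
    LTwo ν n →L[ℂ] LTwo ν n :=
  LinearMap.mkContinuous
    { toFun := fun ψ => (memLp_mul ν hg hb ψ).toLp
      map_add' := fun ψ φ => by
        rw [← MemLp.toLp_add, MemLp.toLp_eq_toLp_iff]
        filter_upwards [Lp.coeFn_add ψ φ] with p hp
        simp only [Pi.add_apply] at hp ⊢
        rw [hp]; ring
      map_smul' := fun c ψ => by
        rw [RingHom.id_apply, ← MemLp.toLp_const_smul, MemLp.toLp_eq_toLp_iff]
        filter_upwards [Lp.coeFn_smul c ψ] with p hp
        simp only [Pi.smul_apply, smul_eq_mul] at hp ⊢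
        rw [hp]; ring }
    1 fun ψ => by
      rw [one_mul]
      refine Lp.norm_le_norm_of_ae_le ?_
      filter_upwards [(memLp_mul ν hg hb ψ).coeFn_toLp] with p hp
      simp only [LinearMap.coe_mk, AddHom.coe_mk]
      rw [hp, norm_mul]
      exact mul_le_of_le_one_left (norm_nonneg _) (hb p)

theorem mulOp_ae {n : ℕ} {g : (Fin n → V) → ℂ} (hg : Measurable g) (hb : ∀ p, ‖g p‖ ≤ 1)
    (ψ : LTwo ν n) : mulOp ν g hg hb ψ =ᵐ[Measure.pi fun _ => ν] fun p => g p * ψ p :=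
  (memLp_mul ν hg hb ψ).coeFn_toLp

theorem norm_mulOp_le {n : ℕ} {g : (Fin n → V) → ℂ} (hg : Measurable g) (hb : ∀ p, ‖g p‖ ≤ 1) :
    ‖mulOp ν g hg hb‖ ≤ 1 :=
  LinearMap.mkContinuous_norm_le _ zero_le_one _

/-- Multiplication by a symmetric function on the bosonic `n`-particle space. -/
def mulSymm {n : ℕ} (g : (Fin n → V) → ℂ) (hg : Measurable g) (hb : ∀ p, ‖g p‖ ≤ 1)
    (hs : ∀ (σ : Equiv.Perm (Fin n)) p, g (fun i => p (σ i)) = g p) :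
    NParticle ν n →L[ℂ] NParticle ν n :=
  ((mulOp ν g hg hb).comp (symmetricSubspace ν n).subtypeL).codRestrict (symmetricSubspace ν n)
    fun ψ σ => by
      have e : permOp ν σ ψ.1 = ψ.1 := ψ.2 σ
      simp only [ContinuousLinearMap.comp_apply, Submodule.subtypeL_apply]
      conv_rhs => rw [← e]
      apply Lp.ext
      have h1 := permOp_ae ν σ (mulOp ν g hg hb ψ.1)
      have h2 := (measurePreserving_perm ν σ).quasiMeasurePreserving.ae_eq (mulOp_ae ν hg hb ψ.1)
      have h3 := mulOp_ae ν hg hb (permOp ν σ ψ.1)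
      have h4 := permOp_ae ν σ ψ.1
      filter_upwards [h1, h2, h3, h4] with p h1 h2 h3 h4
      simp only [Function.comp_apply] at h2
      rw [h1, h2]
      refine Eq.trans ?_ h3.symm
      rw [h4, hs]

theorem norm_mulSymm_le {n : ℕ} {g : (Fin n → V) → ℂ} (hg : Measurable g) (hb : ∀ p, ‖g p‖ ≤ 1)
    (hs : ∀ (σ : Equiv.Perm (Fin n)) p, g (fun i => p (σ i)) = g p) :
    ‖mulSymm ν g hg hb hs‖ ≤ 1 :=
  ContinuousLinearMap.opNorm_le_bound _ zero_le_one fun ψ =>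
    (mulOp ν g hg hb).le_of_opNorm_le (norm_mulOp_le ν hg hb) ψ.1

end Momentum

/-- Minkowski space with coordinates `x^0, x^1, x^2, x^3` (time first) and Lebesgue measure `d⁴x`. -/
abbrev Spacetime : Type := EuclideanSpace ℝ (Fin 4)

/-- The space of three-momenta. -/
abbrev Space : Type := EuclideanSpace ℝ (Fin 3)

/-- The Minkowski product `p · x = p^0 x^0 - ∑ p^i x^i`. -/
def mdot (p x : Spacetime) : ℝ := p 0 * x 0 - ∑ i : Fin 3, p i.succ * x i.succ

/-- The point `(|p|, p)` of the future light cone over the three-momentum `p`. -/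
def onShell (p : Space) : Spacetime := WithLp.toLp 2 (Fin.cons ‖p‖ fun i => p i)

/-- `Ĵ(p) = (2π)^{-2} ∫ e^{i p · x} J(x) d⁴x`. -/
def minkowskiFourier (J : Spacetime → ℂ) (p : Spacetime) : ℂ :=
  (1 / (2 * Real.pi : ℂ) ^ 2) * ∫ x, Complex.exp (Complex.I * mdot p x) * J x

/-- The measure `(2π)^{-3} θ(p^0) δ(p²) d⁴p = (2π)^{-3} d³p / (2|p|)` on the future light cone,
parametrised by the three-momentum. -/
def coneMeasure : Measure Space :=
  volume.withDensity fun p => ENNReal.ofReal (1 / ((2 * Real.pi) ^ 3 * (2 * ‖p‖)))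

instance : SigmaFinite coneMeasure := by unfold coneMeasure; infer_instance

/-- The bosonic Fock space over the one-particle space `L²(coneMeasure)`, that is, over the completion
of the Schwartz functions in `(J₁, J₂) = (2π)^{-3} ∫ θ(p^0) δ(p²) conj(Ĵ₁(p)) Ĵ₂(p) d⁴p`. -/
abbrev Fock : Type := lp (NParticle coneMeasure) 2

theorem continuous_onShell : Continuous onShell := by
  unfold onShell
  refine (PiLp.continuous_toLp 2 _).comp (continuous_pi fun i => ?_)
  refine Fin.cases ?_ (fun j => ?_) i
  · exact continuous_norm
  · simpa using! (by fun_prop : Continuous fun p : Space => p j)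

/-- Auxiliary change of variables that relates `minkowskiFourier` to the Fourier transform of Mathlib. -/
def metricFlip (p : Spacetime) : Spacetime :=
  WithLp.toLp 2 (Fin.cons (-(p 0) / (2 * Real.pi)) fun i => p i.succ / (2 * Real.pi))

theorem minkowskiFourier_eq (J : 𝓢(Spacetime, ℂ)) (p : Spacetime) :
    minkowskiFourier J p = (1 / (2 * Real.pi : ℂ) ^ 2) * (FourierTransform.fourier J) (metricFlip p) := by
  rw [SchwartzMap.fourier_coe, Real.fourier_eq', minkowskiFourier]
  congr 1
  refine integral_congr_ae (Eventually.of_forall fun x => ?_)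
  simp only [smul_eq_mul]
  congr 2
  rw [mul_comm Complex.I]
  congr 2
  have h0 : (metricFlip p) 0 = -(p 0) / (2 * Real.pi) := rfl
  have h1 : ∀ i : Fin 3, (metricFlip p) i.succ = p i.succ / (2 * Real.pi) := fun i => rfl
  rw [PiLp.inner_apply, Fin.sum_univ_succ, mdot]
  simp only [h0, h1, RCLike.inner_apply, conj_trivial]
  have : ∀ i : Fin 3, p i.succ / (2 * Real.pi) * x i.succ = (2 * Real.pi)⁻¹ * (p i.succ * x i.succ) :=
    fun i => by ring
  simp only [this, ← Finset.mul_sum]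
  field_simp
  ring

theorem norm_metricFlip_ge (p : Space) : ‖p‖ / (2 * Real.pi) ≤ ‖metricFlip (onShell p)‖ := by
  have := PiLp.norm_apply_le (metricFlip (onShell p)) 0
  refine le_trans (le_of_eq ?_) this
  simp [metricFlip, onShell, abs_of_pos Real.pi_pos]

theorem memLp_minkowskiFourier (J : 𝓢(Spacetime, ℂ)) :
    MemLp (fun p : Space => minkowskiFourier J (onShell p)) 2 coneMeasure := by
  have hcont : Continuous fun p : Space => minkowskiFourier J (onShell p) := by
    simp only [minkowskiFourier_eq]
    refine continuous_const.mul ((FourierTransform.fourier J).continuous.comp ?_)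
    have : Continuous metricFlip := by
      unfold metricFlip
      refine (PiLp.continuous_toLp 2 _).comp (continuous_pi fun i => ?_)
      refine Fin.cases ?_ (fun j => ?_) i
      · simp only [Fin.cons_zero]; fun_prop
      · simp only [Fin.cons_succ]; fun_prop
    exact this.comp continuous_onShell
  obtain ⟨C, hCpos, hC⟩ : ∃ C : ℝ, 0 < C ∧ ∀ p : Space,
      ‖minkowskiFourier J (onShell p)‖ ^ 2 ≤ C * (1 + ‖p‖ ^ 2)⁻¹ ^ 2 := by
    obtain ⟨C0, h0, hC0⟩ := (FourierTransform.fourier J).decay 0 0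
    obtain ⟨C2, h2, hC2⟩ := (FourierTransform.fourier J).decay 2 0
    refine ⟨((1 / (2 * Real.pi) ^ 2) * (C0 + (2 * Real.pi) ^ 2 * C2)) ^ 2, by positivity,
      fun p => ?_⟩
    rw [← mul_pow]
    refine pow_le_pow_left₀ (norm_nonneg _) ?_ 2
    have e := minkowskiFourier_eq J (onShell p)
    have e0 := hC0 (metricFlip (onShell p))
    have e2 := hC2 (metricFlip (onShell p))
    simp only [norm_iteratedFDeriv_zero, pow_zero, one_mul] at e0 e2
    have hn : ‖p‖ ^ 2 * ‖(FourierTransform.fourier J) (metricFlip (onShell p))‖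
        ≤ (2 * Real.pi) ^ 2 * C2 := by
      have h1 : ‖p‖ ≤ 2 * Real.pi * ‖metricFlip (onShell p)‖ := by
        have := norm_metricFlip_ge p
        rwa [div_le_iff₀' (by positivity)] at this
      calc _ ≤ (2 * Real.pi * ‖metricFlip (onShell p)‖) ^ 2 *
            ‖(FourierTransform.fourier J) (metricFlip (onShell p))‖ := by gcongr
        _ = (2 * Real.pi) ^ 2 * (‖metricFlip (onShell p)‖ ^ 2 *
            ‖(FourierTransform.fourier J) (metricFlip (onShell p))‖) := by ring
        _ ≤ _ := by gcongr
    rw [e, norm_mul, ← div_eq_mul_inv, le_div_iff₀ (by positivity)]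
    have : ‖(1 / (2 * Real.pi : ℂ) ^ 2)‖ = 1 / (2 * Real.pi) ^ 2 := by
      simp [abs_of_pos Real.pi_pos]
    rw [this, mul_assoc]
    refine mul_le_mul_of_nonneg_left ?_ (by positivity)
    nlinarith
  refine (memLp_two_iff_integrable_sq_norm hcont.aestronglyMeasurable).mpr ?_
  unfold coneMeasure
  rw [integrable_withDensity_iff (by fun_prop) (Eventually.of_forall fun _ => ENNReal.ofReal_lt_top)]
  have key : Integrable (fun p : Space =>
      C * ((1 + ‖p‖ ^ 2)⁻¹ ^ 2 * (1 / ((2 * Real.pi) ^ 3 * (2 * ‖p‖))))) := by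
    refine Integrable.const_mul ?_ C
    refine (integrable_fun_norm_addHaar (E := Space) volume
      (f := fun y => (1 + y ^ 2)⁻¹ ^ 2 * (1 / ((2 * Real.pi) ^ 3 * (2 * y))))).mpr ?_
    have hd : IntegrableOn (fun y : ℝ => (1 / ((2 * Real.pi) ^ 3 * 2)) * (1 + y ^ 2)⁻¹)
        (Set.Ioi 0) := (integrable_inv_one_add_sq.const_mul _).integrableOn
    refine Integrable.mono' hd (Measurable.aestronglyMeasurable (by fun_prop)) ?_
    refine (ae_restrict_iff' measurableSet_Ioi).mpr (Eventually.of_forall fun y hy => ?_)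
    have hy : 0 < y := hy
    rw [Real.norm_of_nonneg (by positivity)]
    simp only [finrank_euclideanSpace, Fintype.card_fin, smul_eq_mul]
    have : y ^ (3 - 1) * ((1 + y ^ 2)⁻¹ ^ 2 * (1 / ((2 * Real.pi) ^ 3 * (2 * y)))) =
        (1 / ((2 * Real.pi) ^ 3 * 2)) * (1 + y ^ 2)⁻¹ * (y * (1 + y ^ 2)⁻¹) := by
      field_simp
    rw [this]
    refine mul_le_of_le_one_right (by positivity) ?_
    rw [← div_eq_mul_inv, div_le_one (by positivity)]
    nlinarith [sq_nonneg (y - 1)]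
  refine Integrable.mono' key (Measurable.aestronglyMeasurable ?_) (Eventually.of_forall fun p => ?_)
  · exact (hcont.norm.pow 2).measurable.mul (by fun_prop)
  · rw [ENNReal.toReal_ofReal (by positivity), Real.norm_of_nonneg (by positivity), ← mul_assoc C]
    exact mul_le_mul_of_nonneg_right (hC p) (by positivity)

/-- The one-particle vector of the test function `J`: the restriction of `Ĵ` to the light cone. -/
def oneParticle (J : 𝓢(Spacetime, ℂ)) : Lp ℂ 2 coneMeasure := (memLp_minkowskiFourier J).toLp

/-- The Weyl operator `W(J) = exp(-i (a(J) + a*(J)))`. -/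
def weyl (J : 𝓢(Spacetime, ℂ)) : Fock →L[ℂ] Fock :=
  weylOp (creation coneMeasure (oneParticle J)) ‖oneParticle J‖ (norm_nonneg _)
    (norm_creation_le coneMeasure (oneParticle J))

theorem memLp_one_zero : MemLp (fun _ : Fin 0 → Space => (1 : ℂ)) 2
    (Measure.pi fun _ : Fin 0 => coneMeasure) := by
  rw [Measure.pi_of_empty]
  exact memLp_const 1

/-- The vacuum vector `Ω = (1, 0, 0, …)`. -/
def vacuum : Fock :=
  lp.single 2 0 ⟨memLp_one_zero.toLp, fun σ => by
    rw [Subsingleton.elim σ 1]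
    apply Lp.ext
    have h1 := permOp_ae coneMeasure 1 memLp_one_zero.toLp
    filter_upwards [h1] with p hp
    rw [hp]; rfl⟩

/-- The total energy-momentum `p_1 + … + p_n` of `n` massless particles. -/
def totalMomentum {n : ℕ} (p : Fin n → Space) : Spacetime := ∑ i, onShell (p i)

theorem measurable_totalMomentum (n : ℕ) : Measurable (totalMomentum (n := n)) := by
  have : Continuous (totalMomentum (n := n)) :=
    continuous_finsetSum _ fun i _ => continuous_onShell.comp (continuous_apply i)
  exact this.measurable

/-- The function `m(P)` of the four-momentum operators `P`: on the `n`-particle space these act as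
multiplication by the components of the total energy-momentum, and `m(P)` is multiplication by `m` of it. -/
def momentumFunction (m : Spacetime → ℂ) (hm : Measurable m) (hb : ∀ p, ‖m p‖ ≤ 1) :
    Fock →L[ℂ] Fock :=
  diagOp (fun n => mulSymm coneMeasure (fun p : Fin n → Space => m (totalMomentum p))
      (hm.comp (measurable_totalMomentum n)) (fun _ => hb _)
      fun σ p => congrArg m (Equiv.sum_comp σ fun i => onShell (p i)))
    fun _ => norm_mulSymm_le coneMeasure _ _ _

theorem continuous_mdot : Continuous fun q : Spacetime × Spacetime => mdot q.1 q.2 := by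
  unfold mdot; fun_prop

/-- The joint spectral family `E(A) = 1_A(P)` of the four-momentum operators. -/
def spectralMeasure (A : Set Spacetime) (hA : MeasurableSet A) : Fock →L[ℂ] Fock :=
  momentumFunction (A.indicator fun _ => 1) (measurable_const.indicator hA) fun p => by
    by_cases h : p ∈ A <;> simp [h]

/-- The spacetime translations `U(x) = e^{i P · x}`. -/
def translation (x : Spacetime) : Fock →L[ℂ] Fock :=
  momentumFunction (fun p => Complex.exp (Complex.I * mdot p x))
    (Complex.continuous_exp.comp (continuous_const.mul (Complex.continuous_ofReal.comp
      (continuous_mdot.comp (continuous_id.prodMk continuous_const))))).measurable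
    fun p => by rw [mul_comm, Complex.norm_exp_ofReal_mul_I]

/-- The set `{p | 0 ≤ p² ≤ μ², p^0 ≥ 0}`. -/
def massShellRegion (μ : ℝ) : Set Spacetime :=
  {p | 0 ≤ mdot p p ∧ mdot p p ≤ μ ^ 2 ∧ 0 ≤ p 0}

theorem measurableSet_massShellRegion (μ : ℝ) : MeasurableSet (massShellRegion μ) := by
  have h : Continuous fun p : Spacetime => mdot p p :=
    continuous_mdot.comp (continuous_id.prodMk continuous_id)
  exact ((isClosed_le continuous_const h).inter ((isClosed_le h continuous_const).inter
    (isClosed_le continuous_const (by fun_prop : Continuous fun p : Spacetime => p 0)))).measurableSet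

/-- The spectral projection `E_μ = E({p | 0 ≤ p² ≤ μ², p^0 ≥ 0})`. -/
def massProjection (μ : ℝ) : Fock →L[ℂ] Fock :=
  spectralMeasure (massShellRegion μ) (measurableSet_massShellRegion μ)

theorem norm_translation_apply_le (x : Spacetime) (Ψ : Fock) : ‖translation x Ψ‖ ≤ ‖Ψ‖ := by
  refine le_trans (ContinuousLinearMap.le_of_opNorm_le _ (c := 1) ?_ Ψ) (one_mul _).le
  unfold translation momentumFunction
  apply norm_diagOp_le

theorem norm_sq_eq_integral {α : Type*} [MeasurableSpace α] {ρ : Measure α} (f : Lp ℂ 2 ρ) :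
    ‖f‖ ^ 2 = ∫ p, ‖f p‖ ^ 2 ∂ρ := by
  have h := L2.inner_def (𝕜 := ℂ) f f
  simp only [inner_self_eq_norm_sq_to_K] at h
  have h' : ((‖f‖ ^ 2 : ℝ) : ℂ) = ((∫ p, ‖f p‖ ^ 2 ∂ρ : ℝ) : ℂ) := by
    rw [← integral_complex_ofReal]
    simpa using h
  exact_mod_cast h'

theorem continuous_translation (Ψ : Fock) : Continuous fun x => translation x Ψ := by
  rw [continuous_iff_continuousAt]
  intro y
  have hlevel : ∀ n, Tendsto (fun x => ‖translation x Ψ n - translation y Ψ n‖ ^ 2) (𝓝 y) (𝓝 0) := by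
    intro n
    let e : Spacetime → (Fin n → Space) → ℂ := fun x p =>
      Complex.exp (Complex.I * mdot (totalMomentum p) x)
    have he1 : ∀ x p, ‖e x p‖ = 1 := fun x p => by
      simp only [e]; rw [mul_comm, Complex.norm_exp_ofReal_mul_I]
    have hec : ∀ p, Continuous fun x => e x p := fun p =>
      Complex.continuous_exp.comp (continuous_const.mul (Complex.continuous_ofReal.comp
        (continuous_mdot.comp (continuous_const.prodMk continuous_id))))
    have hem : ∀ x, Measurable (e x) := fun x =>
      (Complex.continuous_exp.comp (continuous_const.mul (Complex.continuous_ofReal.comp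
      (continuous_mdot.comp (continuous_id.prodMk continuous_const))))).measurable.comp
        (measurable_totalMomentum n)
    have hn : ∀ x, ‖translation x Ψ n - translation y Ψ n‖ ^ 2 =
        ∫ p, ‖(e x p - e y p) * (Ψ n).1 p‖ ^ 2 ∂(Measure.pi fun _ : Fin n => coneMeasure) := by
      intro x
      have h1 : translation x Ψ n - translation y Ψ n =
        ((mulOp coneMeasure (e x) (hem x) (fun p => (he1 x p).le) (Ψ n).1 -
          mulOp coneMeasure (e y) (hem y) (fun p => (he1 y p).le) (Ψ n).1 : LTwo coneMeasure n)) := rfl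
      have h2 := norm_sq_eq_integral
        (mulOp coneMeasure (e x) (hem x) (fun p => (he1 x p).le) (Ψ n).1 -
          mulOp coneMeasure (e y) (hem y) (fun p => (he1 y p).le) (Ψ n).1 : LTwo coneMeasure n)
      refine (congrArg (fun v : LTwo coneMeasure n => ‖v‖ ^ 2) h1).trans (h2.trans ?_)
      refine integral_congr_ae ?_
      filter_upwards [Lp.coeFn_sub (mulOp coneMeasure (e x) (hem x) (fun p => (he1 x p).le) (Ψ n).1)
          (mulOp coneMeasure (e y) (hem y) (fun p => (he1 y p).le) (Ψ n).1),
        mulOp_ae coneMeasure (hem x) (fun p => (he1 x p).le) (Ψ n).1,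
        mulOp_ae coneMeasure (hem y) (fun p => (he1 y p).le) (Ψ n).1] with p a1 a2 a3
      rw [a1, Pi.sub_apply, a2, a3, sub_mul]
    simp only [hn]
    rw [show (0 : ℝ) = ∫ p, ‖(e y p - e y p) * (Ψ n).1 p‖ ^ 2
      ∂(Measure.pi fun _ : Fin n => coneMeasure) by simp]
    have hψ := (memLp_two_iff_integrable_sq_norm (Lp.aestronglyMeasurable (Ψ n).1)).mp
      (Lp.memLp (Ψ n).1)
    refine tendsto_integral_filter_of_dominated_convergence
      (fun p => 4 * ‖(Ψ n).1 p‖ ^ 2) ?_ ?_ (hψ.const_mul 4) ?_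
    · exact Eventually.of_forall fun x => ((((hem x).sub (hem y)).aestronglyMeasurable.mul
        (Lp.aestronglyMeasurable (Ψ n).1)).norm.pow 2)
    · refine Eventually.of_forall fun x => Eventually.of_forall fun p => ?_
      have : ‖e x p - e y p‖ ≤ 2 := (norm_sub_le _ _).trans (by rw [he1, he1]; norm_num)
      rw [Real.norm_of_nonneg (by positivity), norm_mul, mul_pow]
      refine mul_le_mul_of_nonneg_right ?_ (by positivity)
      nlinarith [norm_nonneg (e x p - e y p)]
    · refine Eventually.of_forall fun p => ?_
      exact ((((hec p).sub continuous_const).mul continuous_const).norm.pow 2).tendsto y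
  have hsum : Tendsto (fun x => ∑' n, ‖translation x Ψ n - translation y Ψ n‖ ^ 2) (𝓝 y)
      (𝓝 (∑' _ : ℕ, (0 : ℝ))) := by
    have hs : Summable fun n => 4 * ‖Ψ n‖ ^ 2 := by
      have := (lp.memℓp Ψ).summable (by norm_num)
      simp only [ENNReal.toReal_ofNat, Real.rpow_ofNat] at this
      exact this.mul_left 4
    refine tendsto_tsum_of_dominated_convergence hs hlevel ?_
    refine Eventually.of_forall fun x n => ?_
    have hb : ∀ x, ‖translation x Ψ n‖ ≤ ‖Ψ n‖ := fun x => by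
      refine le_trans (ContinuousLinearMap.le_of_opNorm_le (c := 1) _ ?_ (Ψ n)) (one_mul _).le
      exact norm_mulSymm_le coneMeasure _ _ _
    rw [Real.norm_of_nonneg (by positivity)]
    have := (norm_sub_le (translation x Ψ n) (translation y Ψ n)).trans (add_le_add (hb x) (hb y))
    nlinarith [norm_nonneg (translation x Ψ n - translation y Ψ n)]
  rw [tsum_zero] at hsum
  have hnorm : ∀ x, ‖translation x Ψ - translation y Ψ‖ ^ 2 =
      ∑' n, ‖translation x Ψ n - translation y Ψ n‖ ^ 2 := fun x => by
    have := lp.norm_rpow_eq_tsum (p := 2) (by norm_num) (translation x Ψ - translation y Ψ)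
    simpa using this
  rw [ContinuousAt, tendsto_iff_norm_sub_tendsto_zero]
  have h2 := (hsum.congr fun x => (hnorm x).symm).sqrt
  simpa [Real.sqrt_sq] using h2

theorem continuous_conj_translation (B : Fock →L[ℂ] Fock) (Ψ : Fock) :
    Continuous fun x => translation x (B (translation (-x) Ψ)) := by
  have h1 : Continuous fun x => B (translation (-x) Ψ) :=
    B.continuous.comp ((continuous_translation Ψ).comp continuous_neg)
  rw [continuous_iff_continuousAt]
  intro y
  rw [ContinuousAt, tendsto_iff_norm_sub_tendsto_zero]
  have h2 : Tendsto (fun x => ‖B (translation (-x) Ψ) - B (translation (-y) Ψ)‖ +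
      ‖translation x (B (translation (-y) Ψ)) - translation y (B (translation (-y) Ψ))‖)
      (𝓝 y) (𝓝 (0 + 0)) :=
    (tendsto_iff_norm_sub_tendsto_zero.mp (h1.tendsto y)).add
      (tendsto_iff_norm_sub_tendsto_zero.mp ((continuous_translation _).tendsto y))
  rw [add_zero] at h2
  refine squeeze_zero (fun _ => norm_nonneg _) (fun x => ?_) h2
  refine le_trans ?_ (add_le_add_left (norm_translation_apply_le x _) _)
  rw [map_sub]
  exact norm_sub_le_norm_sub_add_norm_sub _ _ _

theorem integrable_smear (B : Fock →L[ℂ] Fock) {χ : Spacetime → ℂ} (hχ : Integrable χ) (Ψ : Fock) :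
    Integrable fun x => χ x • translation x (B (translation (-x) Ψ)) := by
  refine Integrable.mono' (hχ.norm.mul_const (‖B‖ * ‖Ψ‖))
    (hχ.aestronglyMeasurable.smul (continuous_conj_translation B Ψ).aestronglyMeasurable)
    (Eventually.of_forall fun x => ?_)
  rw [norm_smul]
  refine mul_le_mul_of_nonneg_left ?_ (norm_nonneg _)
  refine (norm_translation_apply_le _ _).trans ((B.le_opNorm _).trans ?_)
  exact mul_le_mul_of_nonneg_left (norm_translation_apply_le _ _) (norm_nonneg _)

/-- The smeared operator `B(χ) = ∫ B(x) χ(x) d⁴x`, where `B(x) = U(x) B U(-x)`, as a strong integral. -/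
def smear (B : Fock →L[ℂ] Fock) (χ : Spacetime → ℂ) (hχ : Integrable χ) : Fock →L[ℂ] Fock :=
  LinearMap.mkContinuous
    { toFun := fun Ψ => ∫ x, χ x • translation x (B (translation (-x) Ψ))
      map_add' := fun Ψ Φ => by
        simp only [map_add, smul_add]
        exact integral_add (integrable_smear B hχ Ψ) (integrable_smear B hχ Φ)
      map_smul' := fun a Ψ => by
        simp only [map_smul, RingHom.id_apply, smul_comm _ a]
        exact integral_smul a _ }
    ((∫ x, ‖χ x‖) * ‖B‖) fun Ψ => by
      simp only [LinearMap.coe_mk, AddHom.coe_mk]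
      rw [mul_assoc, ← integral_mul_const]
      refine norm_integral_le_of_norm_le (hχ.norm.mul_const _) (Eventually.of_forall fun x => ?_)
      rw [norm_smul]
      refine mul_le_mul_of_nonneg_left ?_ (norm_nonneg _)
      refine (norm_translation_apply_le _ _).trans ((B.le_opNorm _).trans ?_)
      exact mul_le_mul_of_nonneg_left (norm_translation_apply_le _ _) (norm_nonneg _)

/-- `B` is smooth: `x ↦ B(x) = U(x) B U(-x)` is infinitely differentiable in the operator norm. -/
def IsSmooth (B : Fock →L[ℂ] Fock) : Prop :=
  ContDiff ℝ ∞ fun x : Spacetime => translation x ∘L B ∘L translation (-x)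

/-- The (energy-momentum) spectral condition: `∫_0^ε ‖(E_μ - E_0) B Ω‖ dμ/μ < ∞` for some `ε > 0`. -/
def SpectralCondition (B : Fock →L[ℂ] Fock) : Prop :=
  ∃ ε : ℝ, 0 < ε ∧
    IntegrableOn (fun μ => ‖(massProjection μ - massProjection 0) (B vacuum)‖ / μ) (Set.Ioc 0 ε)

end FreeField
end

/-! Write `f` for `oneParticle J`, the restriction of the Fourier transform of `J` to the light
cone. `W(J)Ω` is a coherent state: its `n`-particle component is a multiple of the product state `f
⊗ ⋯ ⊗ f`. The span of the product states is stable under `a + a*`, and the vectors with all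
components in these spans form a closed subspace, so the exponential series applied to the vacuum
stays there (`weylOp_single_mem_productStates`). The coefficients are never needed.

With fewer than two massless particles the invariant mass is zero and `E_μ - E_0` vanishes.
Otherwise, all products `p_i · p_j` of light-like momenta are nonnegative, so a total mass at most
`μ` forces `2 p_0 · p_1 ≤ μ²`: the first two momenta are nearly collinear. For fixed lengths this
confines one direction to a cap of spherical measure `O(μ² / (|p_0||p_1|))`. The decay of `f` and
the densities `d³p/|p|` leave convergent radial integrals, so such pairs carry weight `O(μ²)`
(`lintegral_lintegral_collinear_le`). The other particles factor out. Hence each component of `(E_μ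
- E_0)W(J)Ω` has squared norm at most `K μ²` times that of the same component of `W(J)Ω`, with `K`
independent of `n` (`norm_massProjection_sub_apply_le`), and summation over `n` gives (i).

For the smeared operator, `U(x)Ω = Ω` and `E_μ` commutes with `U(x)`, so the linear bound survives
with the factor `‖χ‖₁`. The spectral integrand is then bounded near `0`; it is measurable because
its numerator is monotone in `μ`. Smoothness is independent of the mass estimate: conjugation by
`U(x)` translates `χ`, smearing is bounded in the `L¹` norm of the test function, and translation of
a Schwartz function is smooth in `L¹` (`contDiff_apply_compSubConst`). -/

noncomputable section
namespace FreeField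

/-! ### Weight of nearly collinear pairs on the light cone -/

/-- Polar coordinates for lower Lebesgue integrals. -/
theorem lintegral_eq_lintegral_toSphere_prod (F : Space → ℝ≥0∞) :
    ∫⁻ q, F q = ∫⁻ x, F ((x.2 : ℝ) • (x.1 : Space))
      ∂((volume : Measure Space).toSphere.prod (Measure.volumeIoiPow 2)) := by
  have hm := (volume : Measure Space).measurePreserving_homeomorphUnitSphereProd
  have hd : Module.finrank ℝ Space - 1 = 2 := by simp
  rw [hd] at hm
  have h1 := hm.lintegral_comp_emb (Homeomorph.measurableEmbedding _)
    (fun x => F ((x.2 : ℝ) • (x.1 : Space)))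
  have h2 : ∫⁻ q, F q = ∫⁻ q in {0}ᶜ, F q := by rw [restrict_compl_singleton]
  rw [← h1, h2, ← lintegral_subtype_comap (measurableSet_singleton (0 : Space)).compl]
  refine lintegral_congr fun x => congrArg F ?_
  exact (congrArg Subtype.val ((homeomorphUnitSphereProd Space).symm_apply_apply x)).symm

open scoped Pointwise in
/-- The spherical measure of the cap `{u | 1 - u · e ≤ t}` is `O(t)`. -/
theorem toSphere_cap_le {e : Space} (he : ‖e‖ = 1) {t : ℝ} (ht : 0 ≤ t) :
    (volume : Measure Space).toSphere {u | 1 - ⟪e, (u : Space)⟫_ℝ ≤ t} ≤ ENNReal.ofReal (48 * t) := by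
  have hms : MeasurableSet {u : Metric.sphere (0 : Space) 1 | 1 - ⟪e, (u : Space)⟫_ℝ ≤ t} :=
    (isClosed_le (by fun_prop) continuous_const).measurableSet
  -- The spherical measure is the dimension times the volume of the solid cone over the cap.
  -- Dimension `3` and a box of volume `16 t` around that cone give the constant `48`.
  rw [Measure.toSphere_apply' _ hms]
  obtain ⟨b, hb⟩ := Orthonormal.exists_orthonormalBasis_extension_of_card_eq (𝕜 := ℝ) (E := Space)
    (ι := Fin 3) (by simp) (v := fun _ => e) (s := {0})
    ⟨fun i => he, fun i j hij => (hij (Subsingleton.elim i j)).elim⟩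
  have hb0 : b 0 = e := hb 0 rfl
  -- Half-widths of the box in a basis starting with `e`: on the cap each transverse coordinate has
  -- square at most `1 - x₀² = (1 - x₀)(1 + x₀) ≤ 2 t`.
  let r : Fin 3 → ℝ := ![1, Real.sqrt (2 * t), Real.sqrt (2 * t)]
  have hs := Real.sqrt_nonneg (2 * t)
  have hsq := Real.mul_self_sqrt (show 0 ≤ 2 * t by positivity)
  have hbox : volume (Set.Icc (-r) r) = ENNReal.ofReal (16 * t) := by
    rw [Real.volume_Icc_pi, ← ENNReal.ofReal_prod_of_nonneg]
    · congr 1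
      simp only [Fin.prod_univ_three, r, Pi.neg_apply, Matrix.cons_val_zero, Matrix.cons_val_one,
        Matrix.cons_val]
      nlinarith
    · intro i _
      fin_cases i <;> simp [r]
  have hmp : MeasurePreserving (fun q : Space => WithLp.ofLp (b.repr q)) :=
    (PiLp.volume_preserving_ofLp (Fin 3)).comp b.measurePreserving_repr
  have hsub : Set.Ioo (0 : ℝ) 1 • ((↑) '' {u : Metric.sphere (0 : Space) 1 |
      1 - ⟪e, (u : Space)⟫_ℝ ≤ t}) ⊆ (fun q : Space => WithLp.ofLp (b.repr q)) ⁻¹' Set.Icc (-r) r := by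
    rintro _ ⟨a, ha, _, ⟨u, hu, rfl⟩, rfl⟩
    have hu1 : ‖(u : Space)‖ = 1 := by simp
    have hn : b.repr u 0 ^ 2 + b.repr u 1 ^ 2 + b.repr u 2 ^ 2 = 1 := by
      have := EuclideanSpace.norm_sq_eq (b.repr u)
      rw [b.repr.norm_map, hu1, Fin.sum_univ_three] at this
      simpa using this.symm
    have h0 : 1 - b.repr u 0 ≤ t := by
      rw [b.repr_apply_apply, hb0]; exact hu
    have habs : ∀ i, |b.repr u i| ≤ r i := by
      intro i
      have h1 : |b.repr u 0| ≤ 1 := abs_le_one_iff_mul_self_le_one.mpr (by nlinarith)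
      have h2 := abs_le.mp h1
      fin_cases i
      · exact h1
      · refine Real.abs_le_sqrt ?_
        change b.repr u 1 ^ 2 ≤ _
        nlinarith [sq_nonneg (b.repr u 2)]
      · refine Real.abs_le_sqrt ?_
        change b.repr u 2 ^ 2 ≤ _
        nlinarith [sq_nonneg (b.repr u 1)]
    have : ∀ i, |b.repr (a • (u : Space)) i| ≤ r i := fun i => by
      rw [map_smul, PiLp.smul_apply, smul_eq_mul, abs_mul, abs_of_pos ha.1]
      exact (mul_le_of_le_one_left (abs_nonneg _) ha.2.le).trans (habs i)
    exact ⟨fun i => (abs_le.mp (this i)).1, fun i => (abs_le.mp (this i)).2⟩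
  calc _ ≤ (Module.finrank ℝ Space : ℝ≥0∞) * ENNReal.ofReal (16 * t) := by
        gcongr
        refine (measure_mono hsub).trans_eq ?_
        rw [hmp.measure_preimage measurableSet_Icc.nullMeasurableSet, hbox]
    _ = _ := by
        rw [finrank_euclideanSpace, Fintype.card_fin, ← ENNReal.ofReal_natCast,
          ← ENNReal.ofReal_mul (by positivity)]
        congr 1
        push_cast
        ring

/-- The radial integral bounding the integral over the directions of momentum close to `p`. -/
theorem lintegral_collinear_le {p : Space} (hp : p ≠ 0) {s : ℝ} (hs : 0 ≤ s) {g : ℝ → ℝ≥0∞}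
    (hg : Measurable g) :
    ∫⁻ q : Space, g ‖q‖ * ENNReal.ofReal (1 / ‖q‖) *
        {q | ‖p‖ * ‖q‖ - ⟪p, q⟫_ℝ ≤ s}.indicator 1 q ≤
      ENNReal.ofReal (48 * s) * ENNReal.ofReal (1 / ‖p‖) * ∫⁻ r in Set.Ioi 0, g r := by
  have hpn : 0 < ‖p‖ := norm_pos_iff.mpr hp
  have hms : MeasurableSet {q : Space | ‖p‖ * ‖q‖ - ⟪p, q⟫_ℝ ≤ s} :=
    (isClosed_le (by fun_prop) continuous_const).measurableSet
  have hind : Measurable ({q : Space | ‖p‖ * ‖q‖ - ⟪p, q⟫_ℝ ≤ s}.indicator (1 : Space → ℝ≥0∞)) :=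
    measurable_const.indicator hms
  have hr : Measurable fun r : ℝ => g r * ENNReal.ofReal (1 / r) := by fun_prop
  rw [lintegral_eq_lintegral_toSphere_prod, lintegral_prod_symm']
  swap
  · have hc : Measurable fun x : Metric.sphere (0 : Space) 1 × Set.Ioi (0 : ℝ) =>
        (x.2 : ℝ) • (x.1 : Space) := by fun_prop
    exact ((hr.comp measurable_norm).mul hind).comp hc
  -- At fixed radius `r` the condition on `q = r u` reads `1 - u · p/|p| ≤ s / (|p| r)`, so the
  -- integral over directions is the measure of a cap.
  have key : ∀ r : Set.Ioi (0 : ℝ), ∫⁻ u : Metric.sphere (0 : Space) 1,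
      g ‖(r : ℝ) • (u : Space)‖ * ENNReal.ofReal (1 / ‖(r : ℝ) • (u : Space)‖) *
        {q | ‖p‖ * ‖q‖ - ⟪p, q⟫_ℝ ≤ s}.indicator 1 ((r : ℝ) • (u : Space))
        ∂(volume : Measure Space).toSphere ≤
      g r * ENNReal.ofReal (1 / r) * ENNReal.ofReal (48 * (s / (‖p‖ * r))) := by
    intro ⟨r, hr0⟩
    have hr0 : 0 < r := hr0
    have hu : ∀ u : Metric.sphere (0 : Space) 1, ‖r • (u : Space)‖ = r := fun u => by
      have : ‖(u : Space)‖ = 1 := by simp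
      rw [norm_smul, this, Real.norm_of_nonneg hr0.le, mul_one]
    have he : ‖‖p‖⁻¹ • p‖ = 1 := by simp [norm_smul, hpn.ne']
    have hset : ∀ u : Metric.sphere (0 : Space) 1,
        ({q | ‖p‖ * ‖q‖ - ⟪p, q⟫_ℝ ≤ s}.indicator 1 (r • (u : Space)) : ℝ≥0∞) =
        {u : Metric.sphere (0 : Space) 1 |
          1 - ⟪‖p‖⁻¹ • p, (u : Space)⟫_ℝ ≤ s / (‖p‖ * r)}.indicator 1 u := by
      intro u
      have : ‖p‖ * ‖r • (u : Space)‖ - ⟪p, r • (u : Space)⟫_ℝ ≤ s ↔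
          1 - ⟪‖p‖⁻¹ • p, (u : Space)⟫_ℝ ≤ s / (‖p‖ * r) := by
        rw [hu, real_inner_smul_right, real_inner_smul_left, le_div_iff₀ (by positivity)]
        have : (1 - ‖p‖⁻¹ * ⟪p, (u : Space)⟫_ℝ) * (‖p‖ * r) = ‖p‖ * r - r * ⟪p, (u : Space)⟫_ℝ := by
          field_simp
        rw [this]
      simp only [Set.indicator_apply, Set.mem_ofPred_eq, this, Pi.one_apply]
    simp only [hu, hset]
    rw [lintegral_const_mul, lintegral_indicator_one]
    · gcongr
      exact toSphere_cap_le he (by positivity)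
    · exact (isClosed_le (by fun_prop) continuous_const).measurableSet
    · exact measurable_const.indicator (isClosed_le (by fun_prop) continuous_const).measurableSet
  refine (lintegral_mono key).trans ?_
  rw [Measure.volumeIoiPow, lintegral_withDensity_eq_lintegral_mul _ (by fun_prop) (by fun_prop)]
  simp only [Pi.mul_apply]
  rw [lintegral_subtype_comap measurableSet_Ioi (f := fun r : ℝ => ENNReal.ofReal (r ^ 2) *
    (g r * ENNReal.ofReal (1 / r) * ENNReal.ofReal (48 * (s / (‖p‖ * r))))),
    ← lintegral_const_mul _ hg]
  -- The weight `r²` of polar coordinates cancels one `1/r` from the density and one from the cap.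
  refine (setLIntegral_congr_fun measurableSet_Ioi fun r hr => ?_).le
  have hr : 0 < r := hr
  have : ENNReal.ofReal (r ^ 2) * (g r * ENNReal.ofReal (1 / r) *
      ENNReal.ofReal (48 * (s / (‖p‖ * r)))) = (ENNReal.ofReal (r ^ 2) * ENNReal.ofReal (1 / r) *
      ENNReal.ofReal (48 * (s / (‖p‖ * r)))) * g r := by ring
  simp only [this]
  rw [← ENNReal.ofReal_mul (by positivity), ← ENNReal.ofReal_mul (by positivity),
    ← ENNReal.ofReal_mul (by positivity)]
  congr 2
  field_simp

/-- Only the `1/|p|` singularity of the invariant measure matters; the numerical constants in its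
density only help. -/
theorem lintegral_coneMeasure_le {F : Space → ℝ≥0∞} (hF : Measurable F) :
    ∫⁻ p, F p ∂coneMeasure ≤ ∫⁻ p, F p * ENNReal.ofReal (1 / ‖p‖) := by
  rw [coneMeasure, lintegral_withDensity_eq_lintegral_mul _ (by fun_prop) hF]
  refine lintegral_mono fun p => ?_
  rw [Pi.mul_apply, mul_comm]
  refine mul_le_mul' le_rfl (ENNReal.ofReal_le_ofReal ?_)
  -- At the origin both densities are `0`, since division by zero gives zero.
  rcases eq_or_ne p 0 with rfl | hp
  · simp
  have hpn : 0 < ‖p‖ := norm_pos_iff.mpr hp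
  refine one_div_le_one_div_of_le hpn ?_
  have h1 : (1 : ℝ) ≤ (2 * Real.pi) ^ 3 := one_le_pow₀ (by linarith [Real.pi_gt_three])
  nlinarith

theorem ae_coneMeasure_ne_zero : ∀ᵐ p ∂coneMeasure, p ≠ 0 :=
  (withDensity_absolutelyContinuous volume _).ae_le (Measure.ae_ne volume 0)

/-- Two light-like momenta with square-integrable, rapidly decaying weights have an invariant mass
squared at most `2 s` only with weight `O(s)`. -/
theorem lintegral_lintegral_collinear_le {F : Space → ℝ≥0∞} {C : ℝ}
    (hF : ∀ᵐ p ∂coneMeasure, F p ≤ ENNReal.ofReal (C * (1 + ‖p‖ ^ 2)⁻¹ ^ 2)) :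
    ∃ K : ℝ, 0 ≤ K ∧ ∀ s : ℝ, 0 ≤ s → ∫⁻ p, ∫⁻ q, F p * F q *
      {q | ‖p‖ * ‖q‖ - ⟪p, q⟫_ℝ ≤ s}.indicator 1 q ∂coneMeasure ∂coneMeasure ≤
        ENNReal.ofReal (K * s) := by
  let g : ℝ → ℝ≥0∞ := fun r => ENNReal.ofReal (C * (1 + r ^ 2)⁻¹ ^ 2)
  have hg : Measurable g := by fun_prop
  have hdec : Integrable fun r : ℝ => C * (1 + r ^ 2)⁻¹ ^ 2 := by
    refine Integrable.const_mul ?_ C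
    refine Integrable.mono' integrable_inv_one_add_sq (Measurable.aestronglyMeasurable (by fun_prop))
      (Eventually.of_forall fun r => ?_)
    rw [Real.norm_of_nonneg (by positivity), sq]
    refine mul_le_of_le_one_right (by positivity) (inv_le_one_of_one_le₀ ?_)
    nlinarith [sq_nonneg r]
  set A : ℝ≥0∞ := ∫⁻ r in Set.Ioi 0, g r with hA
  have hAfin : A ≠ ⊤ := hdec.integrableOn.lintegral_lt_top.ne
  -- `A` is the radial integral left by the inner variable. `B` collects the outer variable with two
  -- factors `1/|p|`, one from the cap estimate and one from the density; in three dimensions the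
  -- radial weight cancels both.
  set B : ℝ≥0∞ := ∫⁻ p : Space, g ‖p‖ * ENNReal.ofReal (1 / ‖p‖) * ENNReal.ofReal (1 / ‖p‖) with hB
  have hBfin : B ≠ ⊤ := by
    have hint : Integrable fun p : Space => C * (1 + ‖p‖ ^ 2)⁻¹ ^ 2 * (1 / ‖p‖) * (1 / ‖p‖) := by
      refine (integrable_fun_norm_addHaar (E := Space) volume
        (f := fun y => C * (1 + y ^ 2)⁻¹ ^ 2 * (1 / y) * (1 / y))).mpr ?_
      refine (integrableOn_congr_fun (fun y hy => ?_) measurableSet_Ioi).mp hdec.integrableOn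
      have hy : 0 < y := hy
      simp only [finrank_euclideanSpace, Fintype.card_fin, smul_eq_mul]
      field_simp
    have := hint.lintegral_lt_top.ne
    refine ne_of_eq_of_ne (lintegral_congr fun p => ?_) this
    rw [ENNReal.ofReal_mul' (by positivity), ENNReal.ofReal_mul' (by positivity)]
  clear_value A B
  refine ⟨48 * (A * B).toReal, by positivity, fun s hs => ?_⟩
  have hind : ∀ p : Space, Measurable
      ({q : Space | ‖p‖ * ‖q‖ - ⟪p, q⟫_ℝ ≤ s}.indicator (1 : Space → ℝ≥0∞)) := fun p =>
    measurable_const.indicator (isClosed_le (by fun_prop) continuous_const).measurableSet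
  have hgn : Measurable fun p : Space => g ‖p‖ := hg.comp measurable_norm
  have inner : ∀ p : Space, p ≠ 0 → ∫⁻ q, g ‖p‖ * g ‖q‖ *
      {q | ‖p‖ * ‖q‖ - ⟪p, q⟫_ℝ ≤ s}.indicator 1 q ∂coneMeasure ≤
      g ‖p‖ * ENNReal.ofReal (1 / ‖p‖) * (ENNReal.ofReal (48 * s) * A) := by
    intro p hp
    simp only [mul_assoc (g ‖p‖)]
    have hm : Measurable fun q : Space => g ‖q‖ *
        {q : Space | ‖p‖ * ‖q‖ - ⟪p, q⟫_ℝ ≤ s}.indicator (1 : Space → ℝ≥0∞) q := hgn.mul (hind p)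
    rw [lintegral_const_mul _ hm]
    gcongr
    refine (lintegral_coneMeasure_le hm).trans ?_
    refine le_trans (le_of_eq (lintegral_congr fun q => ?_))
      ((lintegral_collinear_le hp hs hg).trans_eq ?_)
    · ring
    · rw [hA]; ring
  calc _ ≤ ∫⁻ p, g ‖p‖ * ENNReal.ofReal (1 / ‖p‖) * (ENNReal.ofReal (48 * s) * A) ∂coneMeasure := by
        refine lintegral_mono_ae ?_
        -- The cap is taken around the direction of `p`, which exists for almost every `p`.
        filter_upwards [hF, ae_coneMeasure_ne_zero] with p hp hp0
        refine le_trans (lintegral_mono_ae ?_) (inner p hp0)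
        filter_upwards [hF] with q hq
        gcongr
    _ ≤ ∫⁻ p : Space, g ‖p‖ * ENNReal.ofReal (1 / ‖p‖) * (ENNReal.ofReal (48 * s) * A) *
          ENNReal.ofReal (1 / ‖p‖) := lintegral_coneMeasure_le (by fun_prop)
    _ = ENNReal.ofReal (48 * s) * A * B := by
        rw [hB, ← lintegral_const_mul _ (by fun_prop)]
        exact lintegral_congr fun p => by ring
    _ = _ := by
        rw [mul_assoc, ← ENNReal.ofReal_toReal (ENNReal.mul_ne_top hAfin hBfin),
          ← ENNReal.ofReal_mul (by positivity)]
        simp only [ENNReal.toReal_ofReal ENNReal.toReal_nonneg]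
        congr 1; ring

/-! ### Decay of the one-particle wave function -/

/-- The one-particle wave function of a test function decays rapidly. -/
theorem exists_decay_minkowskiFourier (J : 𝓢(Spacetime, ℂ)) : ∃ C : ℝ, ∀ p : Space,
    ‖minkowskiFourier J (onShell p)‖ ^ 2 ≤ C * (1 + ‖p‖ ^ 2)⁻¹ ^ 2 := by
  obtain ⟨C0, h0, hC0⟩ := (FourierTransform.fourier J).decay 0 0
  obtain ⟨C2, h2, hC2⟩ := (FourierTransform.fourier J).decay 2 0
  refine ⟨((1 / (2 * Real.pi) ^ 2) * (C0 + (2 * Real.pi) ^ 2 * C2)) ^ 2, fun p => ?_⟩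
  rw [← mul_pow]
  refine pow_le_pow_left₀ (norm_nonneg _) ?_ 2
  have e0 := hC0 (metricFlip (onShell p))
  have e2 := hC2 (metricFlip (onShell p))
  simp only [norm_iteratedFDeriv_zero, pow_zero, one_mul] at e0 e2
  have hn : ‖p‖ ^ 2 * ‖(FourierTransform.fourier J) (metricFlip (onShell p))‖
      ≤ (2 * Real.pi) ^ 2 * C2 := by
    have h1 : ‖p‖ ≤ 2 * Real.pi * ‖metricFlip (onShell p)‖ := by
      have := norm_metricFlip_ge p
      rwa [div_le_iff₀' (by positivity)] at this
    calc _ ≤ (2 * Real.pi * ‖metricFlip (onShell p)‖) ^ 2 *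
          ‖(FourierTransform.fourier J) (metricFlip (onShell p))‖ := by gcongr
      _ = (2 * Real.pi) ^ 2 * (‖metricFlip (onShell p)‖ ^ 2 *
          ‖(FourierTransform.fourier J) (metricFlip (onShell p))‖) := by ring
      _ ≤ _ := by gcongr
  rw [minkowskiFourier_eq, norm_mul, ← div_eq_mul_inv, le_div_iff₀ (by positivity)]
  have : ‖(1 / (2 * Real.pi : ℂ) ^ 2)‖ = 1 / (2 * Real.pi) ^ 2 := by
    simp [abs_of_pos Real.pi_pos]
  rw [this, mul_assoc]
  refine mul_le_mul_of_nonneg_left ?_ (by positivity)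
  nlinarith

theorem ae_enorm_sq_oneParticle_le (J : 𝓢(Spacetime, ℂ)) : ∃ C : ℝ, ∀ᵐ p ∂coneMeasure,
    ‖oneParticle J p‖ₑ ^ 2 ≤ ENNReal.ofReal (C * (1 + ‖p‖ ^ 2)⁻¹ ^ 2) := by
  obtain ⟨C, hC⟩ := exists_decay_minkowskiFourier J
  refine ⟨C, ?_⟩
  filter_upwards [(memLp_minkowskiFourier J).coeFn_toLp] with p hp
  have : oneParticle J p = minkowskiFourier J (onShell p) := hp
  rw [this, ← ofReal_norm, ← ENNReal.ofReal_pow (norm_nonneg _)]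
  exact ENNReal.ofReal_le_ofReal (hC p)

/-! ### Product states and the exponential of the field operator -/

section TensorPower
variable {V : Type*} [MeasurableSpace V] (ν : Measure V) [SigmaFinite ν]

theorem memLp_prod (f : Lp ℂ 2 ν) (n : ℕ) :
    MemLp (fun p : Fin n → V => ∏ i, f (p i)) 2 (Measure.pi fun _ => ν) := by
  induction n with
  | zero =>
    rw [Measure.pi_of_empty]
    simp
  | succ n ih =>
    refine (memLp_congr_ae ?_).mp (memLp_insert ν 0 f ih.toLp)
    filter_upwards [(Measure.quasiMeasurePreserving_snd.comp
      (measurePreserving_split ν (0 : Fin (n + 1))).quasiMeasurePreserving).ae_eq ih.coeFn_toLp]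
      with p hp
    simp only [Function.comp_apply] at hp
    rw [hp, Fin.prod_univ_succAbove _ 0]
    rfl

/-- The product state `f ⊗ ⋯ ⊗ f` of `n` bosons. -/
def tensorPower (f : Lp ℂ 2 ν) (n : ℕ) : NParticle ν n :=
  ⟨(memLp_prod ν f n).toLp, fun σ => by
    apply Lp.ext
    filter_upwards [permOp_ae ν σ (memLp_prod ν f n).toLp, (memLp_prod ν f n).coeFn_toLp,
      (measurePreserving_perm ν σ).quasiMeasurePreserving.ae_eq (memLp_prod ν f n).coeFn_toLp]
      with p h1 h2 h3
    simp only [Function.comp_apply] at h3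
    rw [h1, h3, h2]
    exact Equiv.prod_comp σ fun i => f (p i)⟩

theorem tensorPower_ae (f : Lp ℂ 2 ν) (n : ℕ) :
    (tensorPower ν f n).1 =ᵐ[Measure.pi fun _ => ν] fun p => ∏ i, f (p i) :=
  (memLp_prod ν f n).coeFn_toLp

theorem insertOp_tensorPower (f : Lp ℂ 2 ν) {n : ℕ} (j : Fin (n + 1)) :
    insertOp ν f j (tensorPower ν f n).1 = (tensorPower ν f (n + 1)).1 := by
  apply Lp.ext
  filter_upwards [insertOp_ae ν f j (tensorPower ν f n).1, tensorPower_ae ν f (n + 1),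
    (Measure.quasiMeasurePreserving_snd.comp
      (measurePreserving_split ν j).quasiMeasurePreserving).ae_eq (tensorPower_ae ν f n)]
    with p h1 h2 h3
  simp only [Function.comp_apply] at h3
  rw [h1, h2, h3, Fin.prod_univ_succAbove _ j]
  rfl

theorem norm_insertOp_apply (f : Lp ℂ 2 ν) {n : ℕ} (j : Fin (n + 1)) (ψ : LTwo ν n) :
    ‖insertOp ν f j ψ‖ = ‖f‖ * ‖ψ‖ := by
  have h : ‖insertOp ν f j ψ‖ = ‖(memLp_insert ν j f ψ).toLp‖ := rfl
  rw [h, Lp.norm_toLp,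
    (lintegral_insert ν j (Lp.aestronglyMeasurable f) (Lp.aestronglyMeasurable ψ)).2,
    ENNReal.toReal_mul]
  rfl

/-- By polarisation: inserting `f` multiplies all norms by `‖f‖`, hence inner products by `‖f‖²`. -/
theorem inner_insertOp (f : Lp ℂ 2 ν) {n : ℕ} (j : Fin (n + 1)) (ψ φ : LTwo ν n) :
    ⟪insertOp ν f j ψ, insertOp ν f j φ⟫_ℂ = (‖f‖ : ℂ) ^ 2 * ⟪ψ, φ⟫_ℂ := by
  rw [inner_eq_sum_norm_sq_div_four, inner_eq_sum_norm_sq_div_four ψ φ, ← map_smul, ← map_add,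
    ← map_sub, ← map_add, ← map_sub]
  have h : ∀ r : ℝ, (RCLike.ofReal r : ℂ) = (r : ℂ) := fun _ => rfl
  simp only [norm_insertOp_apply, h]
  push_cast
  ring

theorem coe_creation (f : Lp ℂ 2 ν) {n : ℕ} (ψ : NParticle ν n) :
    (creation ν f n ψ : LTwo ν (n + 1)) =
      (Real.sqrt (n + 1) : ℂ)⁻¹ • ∑ j : Fin (n + 1), insertOp ν f j ψ.1 := by
  simp [creation]

theorem creation_tensorPower (f : Lp ℂ 2 ν) (n : ℕ) :
    creation ν f n (tensorPower ν f n) = ((Real.sqrt (n + 1) : ℂ)⁻¹ * (n + 1)) •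
      tensorPower ν f (n + 1) := by
  apply Subtype.ext
  rw [coe_creation]
  simp only [insertOp_tensorPower, Finset.sum_const, Finset.card_univ, Fintype.card_fin]
  rw [← Nat.cast_smul_eq_nsmul ℂ, smul_smul]
  push_cast
  rfl

/-- Tested against `a*(f) φ`, a multiple of the sum of the `n + 1` insertions of `f` into `φ`. The
product state is itself an insertion at every position `j`, so by `inner_insertOp` all terms are
equal. -/
theorem adjoint_creation_tensorPower (f : Lp ℂ 2 ν) (n : ℕ) :
    ContinuousLinearMap.adjoint (creation ν f n) (tensorPower ν f (n + 1)) =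
      ((Real.sqrt (n + 1) : ℂ)⁻¹ * (n + 1) * (‖f‖ : ℂ) ^ 2) • tensorPower ν f n := by
  refine ext_inner_right ℂ fun φ => ?_
  rw [ContinuousLinearMap.adjoint_inner_left, Submodule.coe_inner,
    Submodule.coe_inner, coe_creation, Submodule.coe_smul, inner_smul_right, inner_smul_left,
    inner_sum]
  have : ∀ j : Fin (n + 1), ⟪(tensorPower ν f (n + 1)).1, insertOp ν f j φ.1⟫_ℂ =
      (‖f‖ : ℂ) ^ 2 * ⟪(tensorPower ν f n).1, φ.1⟫_ℂ := fun j => by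
    rw [← insertOp_tensorPower ν f j, inner_insertOp]
  simp only [this, Finset.sum_const, Finset.card_univ, Fintype.card_fin, nsmul_eq_mul, map_mul,
    map_inv₀, map_pow, Complex.conj_ofReal, map_add, map_natCast, map_one]
  push_cast
  ring

/-- The last factor is the norm of the constant `1` on the zero-particle space. It is not evaluated
because only ratios of these norms are used. -/
theorem norm_tensorPower (f : Lp ℂ 2 ν) (n : ℕ) : ‖tensorPower ν f n‖ =
    ‖f‖ ^ n * ‖tensorPower ν f 0‖ := by
  induction n with
  | zero => simp
  | succ n ih =>
    rw [← Submodule.norm_coe, ← insertOp_tensorPower ν f 0, norm_insertOp_apply,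
      Submodule.norm_coe, ih]
    ring

/-- The Fock space vectors all of whose components are multiples of the product states of `f`. -/
def productStates (f : Lp ℂ 2 ν) : Submodule ℂ (lp (NParticle ν) 2) where
  carrier := {Ψ | ∀ n, Ψ n ∈ Submodule.span ℂ {tensorPower ν f n}}
  add_mem' := fun ha hb n => Submodule.add_mem _ (ha n) (hb n)
  zero_mem' := fun _ => Submodule.zero_mem _
  smul_mem' := fun c _ hx n => Submodule.smul_mem _ c (hx n)

/-- Components depend continuously on the vector, and a line is closed. This lets the subspace
contain the limit of the exponential series. -/
theorem isClosed_productStates (f : Lp ℂ 2 ν) :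
    IsClosed (productStates ν f : Set (lp (NParticle ν) 2)) := by
  have : (productStates ν f : Set (lp (NParticle ν) 2)) =
      ⋂ n, (fun Ψ : lp (NParticle ν) 2 => Ψ n) ⁻¹'
        (Submodule.span ℂ {tensorPower ν f n} : Set (NParticle ν n)) := by
    ext; simp only [Set.mem_iInter]; rfl
  rw [this]
  refine isClosed_iInter fun n => IsClosed.preimage ?_ (Submodule.closed_of_finiteDimensional _)
  exact (continuous_apply n).comp (lp.uniformContinuous_coe (p := 2)).continuous

/-- Creation and annihilation by `f` shift product states of `f` to multiples of the neighbouring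
ones, and annihilation kills level zero. -/
theorem fieldOp_mem_span (f : Lp ℂ 2 ν) {Ψ : DirectSum ℕ (NParticle ν)}
    (hΨ : Ψ ∈ Submodule.span ℂ (Set.range fun n =>
      DirectSum.lof ℂ ℕ (NParticle ν) n (tensorPower ν f n))) :
    fieldOp (creation ν f) Ψ ∈ Submodule.span ℂ (Set.range fun n =>
      DirectSum.lof ℂ ℕ (NParticle ν) n (tensorPower ν f n)) := by
  set S := Submodule.span ℂ (Set.range fun n =>
      DirectSum.lof ℂ ℕ (NParticle ν) n (tensorPower ν f n)) with hS
  have hmem : ∀ n, DirectSum.lof ℂ ℕ (NParticle ν) n (tensorPower ν f n) ∈ S := fun n =>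
    Submodule.subset_span ⟨n, rfl⟩
  suffices h : S ≤ S.comap (fieldOp (creation ν f)) from h hΨ
  conv_lhs => rw [hS]
  refine Submodule.span_le.mpr ?_
  rintro _ ⟨n, rfl⟩
  change lowerOp _ _ + raiseOp _ _ ∈ S
  refine S.add_mem ?_ ?_
  · cases n with
    | zero => simp [lowerOp]
    | succ m =>
      have : lowerOp (creation ν f) (DirectSum.lof ℂ ℕ (NParticle ν) (m + 1)
          (tensorPower ν f (m + 1))) = DirectSum.lof ℂ ℕ (NParticle ν) m
          (ContinuousLinearMap.adjoint (creation ν f m) (tensorPower ν f (m + 1))) := by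
        simp [lowerOp]
      simp only [this, adjoint_creation_tensorPower, map_smul]
      exact S.smul_mem _ (hmem m)
  · have : raiseOp (creation ν f) (DirectSum.lof ℂ ℕ (NParticle ν) n (tensorPower ν f n)) =
        DirectSum.lof ℂ ℕ (NParticle ν) (n + 1) (creation ν f n (tensorPower ν f n)) := by
      simp [raiseOp]
    simp only [this, creation_tensorPower, map_smul]
    exact S.smul_mem _ (hmem (n + 1))

/-- The exponential of the field operator maps the vacuum to a superposition of product states. -/
theorem weylOp_single_mem_productStates (f : Lp ℂ 2 ν) (C : ℝ) (hC : 0 ≤ C)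
    (hc : ∀ n, ‖creation ν f n‖ ≤ C * Real.sqrt (n + 1)) :
    weylOp (creation ν f) C hC hc (lp.single 2 0 (tensorPower ν f 0)) ∈ productStates ν f := by
  set S := Submodule.span ℂ (Set.range fun n =>
      DirectSum.lof ℂ ℕ (NParticle ν) n (tensorPower ν f n)) with hS
  have hincl : S ≤ (productStates ν f).comap (incl (NParticle ν)) := by
    refine Submodule.span_le.mpr ?_
    rintro _ ⟨n, rfl⟩ m
    rw [incl_lof]
    by_cases h : m = n
    · subst h
      rw [lp.single_apply_self]
      exact Submodule.mem_span_singleton_self _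
    · rw [lp.single_apply_ne _ _ _ h]
      exact Submodule.zero_mem _
  have hpow : ∀ k, ((fieldOp (creation ν f)) ^ k)
      (DirectSum.lof ℂ ℕ (NParticle ν) 0 (tensorPower ν f 0)) ∈ S := by
    intro k
    induction k with
    | zero => exact Submodule.subset_span ⟨0, rfl⟩
    | succ k ih =>
      rw [pow_succ', Module.End.mul_apply]
      exact fieldOp_mem_span ν f ih
  rw [← incl_lof]
  refine (isClosed_productStates ν f).mem_of_tendsto
    (weylOp_incl (creation ν f) C hC hc _) (Eventually.of_forall fun s => ?_)
  exact Submodule.sum_mem _ fun k _ => Submodule.smul_mem _ _ (hincl (hpow k))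

end TensorPower

/-- The empty product is `1` whatever `f` is, so the vacuum counts as a product state of any `f`. -/
theorem vacuum_eq_single (f : Lp ℂ 2 coneMeasure) :
    vacuum = lp.single 2 0 (tensorPower coneMeasure f 0) := by
  unfold vacuum
  congr 1

theorem exists_weyl_vacuum_apply_eq (J : 𝓢(Spacetime, ℂ)) (n : ℕ) :
    ∃ s : ℂ, weyl J vacuum n = s • tensorPower coneMeasure (oneParticle J) n := by
  have := weylOp_single_mem_productStates coneMeasure (oneParticle J) ‖oneParticle J‖ (norm_nonneg _)
    (norm_creation_le coneMeasure (oneParticle J)) n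
  rw [← vacuum_eq_single] at this
  obtain ⟨s, hs⟩ := Submodule.mem_span_singleton.mp this
  exact ⟨s, hs.symm⟩

/-! ### Kinematics of massless particles -/

theorem mdot_comm (p q : Spacetime) : mdot p q = mdot q p := by
  simp only [mdot, mul_comm]

theorem mdot_sum_left {ι : Type*} (s : Finset ι) (f : ι → Spacetime) (q : Spacetime) :
    mdot (∑ i ∈ s, f i) q = ∑ i ∈ s, mdot (f i) q := by
  simp only [mdot, WithLp.ofLp_sum, Finset.sum_apply, Finset.sum_mul, Finset.sum_sub_distrib]
  congr 1
  exact Finset.sum_comm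

theorem mdot_onShell (p q : Space) : mdot (onShell p) (onShell q) = ‖p‖ * ‖q‖ - ⟪p, q⟫_ℝ := by
  simp [mdot, onShell, PiLp.inner_apply, mul_comm]

theorem mdot_onShell_nonneg (p q : Space) : 0 ≤ mdot (onShell p) (onShell q) := by
  rw [mdot_onShell]
  linarith [real_inner_le_norm p q]

theorem mdot_totalMomentum {n : ℕ} (p : Fin n → Space) :
    mdot (totalMomentum p) (totalMomentum p) = ∑ i, ∑ j, mdot (onShell (p i)) (onShell (p j)) := by
  rw [totalMomentum, mdot_sum_left]
  refine Finset.sum_congr rfl fun i _ => ?_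
  rw [mdot_comm, mdot_sum_left]
  exact Finset.sum_congr rfl fun j _ => mdot_comm _ _

theorem mdot_totalMomentum_nonneg {n : ℕ} (p : Fin n → Space) :
    0 ≤ mdot (totalMomentum p) (totalMomentum p) := by
  rw [mdot_totalMomentum]
  exact Finset.sum_nonneg fun i _ => Finset.sum_nonneg fun j _ => mdot_onShell_nonneg _ _

theorem totalMomentum_zero_nonneg {n : ℕ} (p : Fin n → Space) : 0 ≤ totalMomentum p 0 := by
  have : totalMomentum p 0 = ∑ i, ‖p i‖ := by
    simp [totalMomentum, onShell, WithLp.ofLp_sum, Finset.sum_apply]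
  rw [this]
  positivity

/-- The invariant mass of a system dominates that of any pair of its particles. -/
theorem two_mul_mdot_le_mdot_totalMomentum {n : ℕ} (p : Fin n → Space) {i j : Fin n} (h : i ≠ j) :
    2 * mdot (onShell (p i)) (onShell (p j)) ≤ mdot (totalMomentum p) (totalMomentum p) := by
  have h0 : ∀ k l, 0 ≤ mdot (onShell (p k)) (onShell (p l)) := fun k l => mdot_onShell_nonneg _ _
  rw [mdot_totalMomentum]
  -- In a double sum of nonnegative terms only the entries `(i, j)` and `(j, i)` are kept.
  have h1 := Finset.add_le_sum (s := Finset.univ)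
    (f := fun k => ∑ l, mdot (onShell (p k)) (onShell (p l)))
    (fun k _ => Finset.sum_nonneg fun l _ => h0 k l) (Finset.mem_univ i) (Finset.mem_univ j) h
  have h2 := Finset.single_le_sum (f := fun l => mdot (onShell (p i)) (onShell (p l)))
    (fun l _ => h0 i l) (Finset.mem_univ j)
  have h3 := Finset.single_le_sum (f := fun l => mdot (onShell (p j)) (onShell (p l)))
    (fun l _ => h0 j l) (Finset.mem_univ i)
  rw [mdot_comm (onShell (p j))] at h3
  linarith

theorem mem_massShellRegion_totalMomentum_iff {n : ℕ} (p : Fin n → Space) (μ : ℝ) :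
    totalMomentum p ∈ massShellRegion μ ↔ mdot (totalMomentum p) (totalMomentum p) ≤ μ ^ 2 :=
  ⟨fun h => h.2.1, fun h => ⟨mdot_totalMomentum_nonneg p, h, totalMomentum_zero_nonneg p⟩⟩

/-! ### The mass projections on wave functions -/

theorem massProjection_sub_ae (μ : ℝ) (Ψ : Fock) (n : ℕ) :
    (((massProjection μ - massProjection 0) Ψ n : NParticle coneMeasure n) : LTwo coneMeasure n)
      =ᵐ[Measure.pi fun _ => coneMeasure]
    fun p => ((massShellRegion μ).indicator 1 (totalMomentum p) -
      (massShellRegion 0).indicator 1 (totalMomentum p)) * (Ψ n).1 p := by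
  have e : (((massProjection μ - massProjection 0) Ψ n : NParticle coneMeasure n) :
      LTwo coneMeasure n) = (massProjection μ Ψ n).1 - (massProjection 0 Ψ n).1 := rfl
  have h : ∀ μ : ℝ, (massProjection μ Ψ n).1 =ᵐ[Measure.pi fun _ => coneMeasure]
      fun p => (massShellRegion μ).indicator 1 (totalMomentum p) * (Ψ n).1 p := fun μ =>
    mulOp_ae coneMeasure ((measurable_const.indicator (measurableSet_massShellRegion μ)).comp
      (measurable_totalMomentum n)) (fun p => by
        by_cases h : totalMomentum p ∈ massShellRegion μ <;> simp [h]) (Ψ n).1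
  rw [e]
  filter_upwards [Lp.coeFn_sub (massProjection μ Ψ n).1 (massProjection 0 Ψ n).1, h μ, h 0]
    with p h1 h2 h3
  rw [h1, Pi.sub_apply, h2, h3, sub_mul]

/-- The vacuum and a single massless particle have invariant mass zero, so both projections act as
the identity on these levels. -/
theorem massProjection_sub_apply_of_lt_two (μ : ℝ) (Ψ : Fock) {n : ℕ} (hn : n < 2) :
    (massProjection μ - massProjection 0) Ψ n = 0 := by
  apply Subtype.ext
  apply Lp.ext
  filter_upwards [massProjection_sub_ae μ Ψ n, Lp.coeFn_zero ℂ 2 (Measure.pi fun _ : Fin n => coneMeasure)]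
    with p h1 h2
  have hm : mdot (totalMomentum p) (totalMomentum p) = 0 := by
    rw [mdot_totalMomentum]
    refine Finset.sum_eq_zero fun i _ => Finset.sum_eq_zero fun j _ => ?_
    have : i = j := by ext; omega
    rw [this, mdot_onShell, real_inner_self_eq_norm_mul_norm, sub_self]
  have hr : ∀ μ : ℝ, totalMomentum p ∈ massShellRegion μ := fun μ => by
    rw [mem_massShellRegion_totalMomentum_iff, hm]; positivity
  rw [h1, Set.indicator_of_mem (hr μ), Set.indicator_of_mem (hr 0)]
  simp only [Pi.one_apply, sub_self, zero_mul]
  exact h2.symm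

/-! ### Factorisation of integrals and the bound on each particle level -/

section Product
variable {V : Type*} [MeasurableSpace V] (ν : Measure V) [SigmaFinite ν]

theorem lintegral_pi_fin_succ {n : ℕ} {G : V → (Fin n → V) → ℝ≥0∞}
    (hG : Measurable (Function.uncurry G)) :
    ∫⁻ p : Fin (n + 1) → V, G (p 0) (fun i => p i.succ) ∂(Measure.pi fun _ => ν) =
      ∫⁻ x, ∫⁻ q, G x q ∂(Measure.pi fun _ => ν) ∂ν :=
  ((measurePreserving_split ν (0 : Fin (n + 1))).lintegral_comp hG).trans
    (lintegral_prod (Function.uncurry G) hG.aemeasurable)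

/-- Tonelli, splitting off one variable twice. It separates the constrained pair from the spectator
particles. -/
theorem lintegral_pi_pair_mul_prod {k : V → V → ℝ≥0∞} (hk : Measurable (Function.uncurry k))
    {g : V → ℝ≥0∞} (hg : Measurable g) (n : ℕ) :
    ∫⁻ p : Fin (n + 2) → V, k (p 0) (p 1) * ∏ i : Fin n, g (p i.succ.succ)
      ∂(Measure.pi fun _ => ν) =
      (∫⁻ p, ∫⁻ q, k p q ∂ν ∂ν) * ∫⁻ p : Fin n → V, ∏ i, g (p i) ∂(Measure.pi fun _ => ν) := by
  have hP : ∀ n, Measurable fun p : Fin n → V => ∏ i, g (p i) := fun n =>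
    Finset.measurable_fun_prod _ fun i _ => hg.comp (measurable_pi_apply i)
  have hm1 : Measurable (Function.uncurry fun (x : V) (q : Fin (n + 1) → V) =>
      k x (q 0) * ∏ i : Fin n, g (q i.succ)) := by
    refine Measurable.mul ?_ ?_
    · exact hk.comp (measurable_fst.prodMk ((measurable_pi_apply 0).comp measurable_snd))
    · exact Finset.measurable_fun_prod _ fun i _ =>
        hg.comp ((measurable_pi_apply i.succ).comp measurable_snd)
  refine (lintegral_pi_fin_succ ν hm1).trans ?_
  have h2 : ∀ x : V, ∫⁻ q : Fin (n + 1) → V, k x (q 0) * ∏ i : Fin n, g (q i.succ)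
      ∂(Measure.pi fun _ => ν) = (∫⁻ q, k x q ∂ν) *
        ∫⁻ p : Fin n → V, ∏ i, g (p i) ∂(Measure.pi fun _ => ν) := by
    intro x
    have hkx : Measurable (k x) := hk.comp measurable_prodMk_left
    have hm2 : Measurable (Function.uncurry fun (y : V) (q : Fin n → V) =>
        k x y * ∏ i : Fin n, g (q i)) :=
      (hkx.comp measurable_fst).mul ((hP n).comp measurable_snd)
    refine (lintegral_pi_fin_succ ν hm2).trans ?_
    simp only [lintegral_const_mul _ (hP n)]
    exact lintegral_mul_const _ hkx
  simp only [h2]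
  exact lintegral_mul_const _ hk.lintegral_prod_right'

end Product

theorem enorm_sq_eq_lintegral {α : Type*} [MeasurableSpace α] {ρ : Measure α} (f : Lp ℂ 2 ρ) :
    ‖f‖ₑ ^ 2 = ∫⁻ p, ‖f p‖ₑ ^ 2 ∂ρ := by
  have h := eLpNorm_eq_lintegral_rpow_enorm_toReal (p := 2) (μ := ρ) (f := f) (by norm_num) (by norm_num)
  rw [Lp.enorm_def, h, ← ENNReal.rpow_natCast, ← ENNReal.rpow_mul]
  simp

theorem enorm_prod {ι : Type*} (s : Finset ι) (z : ι → ℂ) : ‖∏ i ∈ s, z i‖ₑ = ∏ i ∈ s, ‖z i‖ₑ := by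
  simp only [enorm, nnnorm_prod, ENNReal.ofNNReal_finsetProd]

theorem enorm_sq_tensorPower (f : Lp ℂ 2 coneMeasure) (n : ℕ) :
    ‖(tensorPower coneMeasure f n).1‖ₑ ^ 2 =
      ∫⁻ p : Fin n → Space, ∏ i, ‖f (p i)‖ₑ ^ 2 ∂(Measure.pi fun _ => coneMeasure) := by
  rw [enorm_sq_eq_lintegral]
  refine lintegral_congr_ae ?_
  filter_upwards [tensorPower_ae coneMeasure f n] with p hp
  rw [hp, Finset.prod_pow, enorm_prod]

/-- On product states with at least two particles only the configurations in which the first two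
momenta are nearly collinear contribute to `E_μ - E_0`. -/
theorem enorm_sq_massProjection_sub_le (f : Lp ℂ 2 coneMeasure) (μ : ℝ) {Ψ : Fock} {n : ℕ} {s : ℂ}
    (hΨ : Ψ (n + 2) = s • tensorPower coneMeasure f (n + 2)) :
    ‖((massProjection μ - massProjection 0) Ψ (n + 2)).1‖ₑ ^ 2 ≤
      ‖s‖ₑ ^ 2 * ((∫⁻ p, ∫⁻ q, ‖f p‖ₑ ^ 2 * ‖f q‖ₑ ^ 2 *
        {q | ‖p‖ * ‖q‖ - ⟪p, q⟫_ℝ ≤ μ ^ 2 / 2}.indicator 1 q ∂coneMeasure ∂coneMeasure) *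
        ‖(tensorPower coneMeasure f n).1‖ₑ ^ 2) := by
  have hf : Measurable fun p => ‖f p‖ₑ ^ 2 := (Lp.stronglyMeasurable f).measurable.enorm.pow_const 2
  let k : Space → Space → ℝ≥0∞ := fun p q => ‖f p‖ₑ ^ 2 * ‖f q‖ₑ ^ 2 *
        {q | ‖p‖ * ‖q‖ - ⟪p, q⟫_ℝ ≤ μ ^ 2 / 2}.indicator 1 q
  have hk : Measurable (Function.uncurry k) := by
    have h1 : MeasurableSet {x : Space × Space | ‖x.1‖ * ‖x.2‖ - ⟪x.1, x.2⟫_ℝ ≤ μ ^ 2 / 2} :=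
      (isClosed_le (by fun_prop) continuous_const).measurableSet
    exact ((hf.comp measurable_fst).mul (hf.comp measurable_snd)).mul
      (measurable_const.indicator h1 : Measurable (Set.indicator _ (1 : Space × Space → ℝ≥0∞)))
  rw [enorm_sq_eq_lintegral, enorm_sq_tensorPower,
    ← lintegral_pi_pair_mul_prod coneMeasure hk hf n, ← lintegral_const_mul']
  swap
  · simp
  refine lintegral_mono_ae ?_
  have hs : (Ψ (n + 2)).1 =ᵐ[Measure.pi fun _ => coneMeasure]
      fun p => s * (tensorPower coneMeasure f (n + 2)).1 p := by
    rw [hΨ]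
    exact Lp.coeFn_smul s (tensorPower coneMeasure f (n + 2)).1
  filter_upwards [massProjection_sub_ae μ Ψ (n + 2), tensorPower_ae coneMeasure f (n + 2), hs]
    with p h1 h2 h3
  rw [h1, h3, h2]
  by_cases hp : totalMomentum p ∈ massShellRegion μ
  · have hpair : ‖p 0‖ * ‖p 1‖ - ⟪p 0, p 1⟫_ℝ ≤ μ ^ 2 / 2 := by
      have a1 := two_mul_mdot_le_mdot_totalMomentum p (show (0 : Fin (n + 2)) ≠ 1 by simp)
      have a2 := (mem_massShellRegion_totalMomentum_iff p μ).mp hp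
      rw [mdot_onShell] at a1
      linarith
    have hk1 : k (p 0) (p 1) = ‖f (p 0)‖ₑ ^ 2 * ‖f (p 1)‖ₑ ^ 2 := by
      simp only [k]
      rw [Set.indicator_of_mem (by exact hpair), Pi.one_apply, mul_one]
    have hprod : ‖∏ i, f (p i)‖ₑ ^ 2 = k (p 0) (p 1) * ∏ i : Fin n, ‖f (p i.succ.succ)‖ₑ ^ 2 := by
      rw [enorm_prod, ← Finset.prod_pow, Fin.prod_univ_succ, Fin.prod_univ_succ, hk1, mul_assoc]
      rfl
    -- Subtracting `E_0` is not exploited here: the difference of indicators is merely bounded by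
    -- `1`.
    have hle : ‖((massShellRegion μ).indicator 1 (totalMomentum p) -
        (massShellRegion 0).indicator 1 (totalMomentum p) : ℂ)‖ₑ ≤ 1 := by
      rw [Set.indicator_of_mem hp]
      by_cases h0 : totalMomentum p ∈ massShellRegion 0 <;> simp [h0]
    rw [enorm_mul, mul_pow, enorm_mul, mul_pow, hprod]
    exact mul_le_of_le_one_left' (pow_le_one' hle 2)
  -- Outside the region of mass `μ` the mass is also nonzero, so both indicators vanish.
  · have hp0 : totalMomentum p ∉ massShellRegion 0 := by
      rw [mem_massShellRegion_totalMomentum_iff] at hp ⊢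
      intro h
      exact hp (h.trans (by simpa using sq_nonneg μ))
    simp [hp, hp0]

/-- The bound is relative to the same component of `W(J)Ω`, with a constant independent of `n`, so
no control of the coefficients of the coherent state is needed when summing over levels. -/
theorem norm_massProjection_sub_apply_le (J : 𝓢(Spacetime, ℂ)) : ∃ K : ℝ, 0 ≤ K ∧
    ∀ (μ : ℝ) (n : ℕ), ‖(massProjection μ - massProjection 0) (weyl J vacuum) n‖ ^ 2 ≤
      K * μ ^ 2 * ‖weyl J vacuum n‖ ^ 2 := by
  set f := oneParticle J with hf
  obtain ⟨C, hC⟩ := ae_enorm_sq_oneParticle_le J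
  obtain ⟨K, hK, hbound⟩ := lintegral_lintegral_collinear_le hC
  -- The pair integral, at most `K μ² / 2`, replaces the factor `‖f‖⁴` that two particles contribute
  -- to the squared norm of the product state.
  refine ⟨K / 2 / ‖f‖ ^ 4, by positivity, fun μ n => ?_⟩
  rcases lt_or_ge n 2 with hn | hn
  · rw [massProjection_sub_apply_of_lt_two μ _ hn, norm_zero, zero_pow two_ne_zero]
    positivity
  obtain ⟨n, rfl⟩ := Nat.exists_eq_add_of_le' hn
  -- If `f = 0` the constant degenerates to zero, so the coefficient must be chosen zero; this is
  -- possible because the product state vanishes.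
  obtain ⟨s, hs, hs0⟩ : ∃ s : ℂ, weyl J vacuum (n + 2) = s • tensorPower coneMeasure f (n + 2) ∧
      (‖f‖ = 0 → s = 0) := by
    obtain ⟨s, hs⟩ := exists_weyl_vacuum_apply_eq J (n + 2)
    by_cases h0 : ‖f‖ = 0
    · have : tensorPower coneMeasure f (n + 2) = 0 := by
        rw [← norm_eq_zero, norm_tensorPower, h0]; simp
      exact ⟨0, by rw [hs, this, smul_zero, smul_zero], fun _ => rfl⟩
    · exact ⟨s, hs, fun h => (h0 h).elim⟩
  have h1 := enorm_sq_massProjection_sub_le f μ hs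
  have h2 : ‖(massProjection μ - massProjection 0) (weyl J vacuum) (n + 2)‖ ^ 2 ≤
      ‖s‖ ^ 2 * (K * (μ ^ 2 / 2) * ‖tensorPower coneMeasure f n‖ ^ 2) := by
    have h3 := h1.trans (mul_le_mul' le_rfl (mul_le_mul' (hbound (μ ^ 2 / 2) (by positivity)) le_rfl))
    rw [← ofReal_norm, ← ofReal_norm, ← ofReal_norm, ← ENNReal.ofReal_pow (norm_nonneg _),
      ← ENNReal.ofReal_pow (norm_nonneg _), ← ENNReal.ofReal_pow (norm_nonneg _),
      ← ENNReal.ofReal_mul (by positivity), ← ENNReal.ofReal_mul (by positivity)] at h3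
    exact (ENNReal.ofReal_le_ofReal_iff (by positivity)).mp h3
  refine h2.trans ?_
  rw [hs, norm_smul, norm_tensorPower coneMeasure f (n + 2), norm_tensorPower coneMeasure f n]
  by_cases h0 : ‖f‖ = 0
  · simp [hs0 h0]
  · refine le_of_eq ?_
    field_simp
    ring

theorem norm_sq_fock (Ψ : Fock) : ‖Ψ‖ ^ 2 = ∑' n, ‖Ψ n‖ ^ 2 := by
  have := lp.norm_rpow_eq_tsum (p := 2) (by norm_num) Ψ
  simpa using this

theorem summable_norm_sq_fock (Ψ : Fock) : Summable fun n => ‖Ψ n‖ ^ 2 := by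
  have := (lp.memℓp Ψ).summable (by norm_num)
  simpa using this

/-- A vector that is dominated level by level is dominated in the Fock space norm. -/
theorem norm_fock_le_of_forall {Ψ Φ : Fock} {c : ℝ} (hc : 0 ≤ c)
    (h : ∀ n, ‖Ψ n‖ ^ 2 ≤ c ^ 2 * ‖Φ n‖ ^ 2) : ‖Ψ‖ ≤ c * ‖Φ‖ := by
  refine (sq_le_sq₀ (norm_nonneg _) (by positivity)).mp ?_
  rw [mul_pow, norm_sq_fock, norm_sq_fock, ← tsum_mul_left]
  exact (summable_norm_sq_fock Ψ).tsum_le_tsum h ((summable_norm_sq_fock Φ).mul_left _)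

theorem exists_norm_massProjection_sub_weyl_vacuum_le (J : 𝓢(Spacetime, ℂ)) :
    ∃ C : ℝ, ∀ μ : ℝ, 0 ≤ μ →
      ‖(massProjection μ - massProjection 0) (weyl J vacuum)‖ ≤ C * μ := by
  obtain ⟨K, hK, h⟩ := norm_massProjection_sub_apply_le J
  refine ⟨Real.sqrt K * ‖weyl J vacuum‖, fun μ hμ => ?_⟩
  rw [mul_right_comm]
  refine norm_fock_le_of_forall (by positivity) fun n => ?_
  rw [mul_pow, Real.sq_sqrt hK]
  exact h μ n

/-! ### Functional calculus, translations and monotonicity in the mass -/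

theorem momentumFunction_ae {m : Spacetime → ℂ} (hm : Measurable m) (hb : ∀ p, ‖m p‖ ≤ 1) (Ψ : Fock)
    (n : ℕ) : (momentumFunction m hm hb Ψ n).1 =ᵐ[Measure.pi fun _ => coneMeasure]
      fun p => m (totalMomentum p) * (Ψ n).1 p :=
  mulOp_ae coneMeasure (hm.comp (measurable_totalMomentum n)) (fun _ => hb _) (Ψ n).1

/-- The functional calculus of the energy-momentum operators is multiplicative. -/
theorem momentumFunction_comp {m₁ m₂ m : Spacetime → ℂ} (hm₁ : Measurable m₁)
    (hb₁ : ∀ p, ‖m₁ p‖ ≤ 1) (hm₂ : Measurable m₂) (hb₂ : ∀ p, ‖m₂ p‖ ≤ 1) (hm : Measurable m)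
    (hb : ∀ p, ‖m p‖ ≤ 1) (h : ∀ p, m₁ p * m₂ p = m p) (Ψ : Fock) :
    momentumFunction m₁ hm₁ hb₁ (momentumFunction m₂ hm₂ hb₂ Ψ) = momentumFunction m hm hb Ψ := by
  ext n : 2
  apply Subtype.ext
  apply Lp.ext
  filter_upwards [momentumFunction_ae hm₁ hb₁ (momentumFunction m₂ hm₂ hb₂ Ψ) n,
    momentumFunction_ae hm₂ hb₂ Ψ n, momentumFunction_ae hm hb Ψ n] with p h1 h2 h3
  rw [h1, h2, h3, ← mul_assoc, h]

theorem norm_exp_mdot_le (x p : Spacetime) : ‖Complex.exp (Complex.I * mdot p x)‖ ≤ 1 := by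
  rw [mul_comm, Complex.norm_exp_ofReal_mul_I]

theorem measurable_exp_mdot (x : Spacetime) :
    Measurable fun p : Spacetime => Complex.exp (Complex.I * mdot p x) :=
  (Complex.continuous_exp.comp (continuous_const.mul (Complex.continuous_ofReal.comp
    (continuous_mdot.comp (continuous_id.prodMk continuous_const))))).measurable

theorem translation_translation (x y : Spacetime) (Ψ : Fock) :
    translation x (translation y Ψ) = translation (x + y) Ψ := by
  refine momentumFunction_comp _ _ _ _ _ _ (fun p => ?_) Ψ
  rw [← Complex.exp_add]
  congr 1
  have : mdot p (x + y) = mdot p x + mdot p y := by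
    simp only [mdot, PiLp.add_apply, mul_add, Finset.sum_add_distrib]
    ring
  rw [this]
  push_cast
  ring

theorem measurable_indicator_massShellRegion (μ : ℝ) :
    Measurable ((massShellRegion μ).indicator fun _ => (1 : ℂ)) :=
  measurable_const.indicator (measurableSet_massShellRegion μ)

theorem norm_indicator_massShellRegion_le (μ : ℝ) (p : Spacetime) :
    ‖(massShellRegion μ).indicator (fun _ => (1 : ℂ)) p‖ ≤ 1 := by
  by_cases h : p ∈ massShellRegion μ <;> simp [h]

theorem massProjection_translation (μ : ℝ) (x : Spacetime) (Ψ : Fock) :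
    massProjection μ (translation x Ψ) = translation x (massProjection μ Ψ) := by
  have hm := measurable_indicator_massShellRegion μ
  have hb := norm_indicator_massShellRegion_le μ
  have hm' := hm.mul (measurable_exp_mdot x)
  have hb' : ∀ p, ‖(massShellRegion μ).indicator (fun _ => (1 : ℂ)) p *
      Complex.exp (Complex.I * mdot p x)‖ ≤ 1 := fun p => by
    rw [norm_mul]
    exact mul_le_one₀ (hb p) (norm_nonneg _) (norm_exp_mdot_le x p)
  have h1 := momentumFunction_comp hm hb (measurable_exp_mdot x) (norm_exp_mdot_le x) hm' hb'
    (fun p => rfl) Ψ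
  have h2 := momentumFunction_comp (measurable_exp_mdot x) (norm_exp_mdot_le x) hm hb hm' hb'
    (fun p => mul_comm _ _) Ψ
  exact h1.trans h2.symm

theorem massShellRegion_mono {μ μ' : ℝ} (h0 : 0 ≤ μ) (h : μ ≤ μ') :
    massShellRegion μ ⊆ massShellRegion μ' := fun _ hp =>
  ⟨hp.1, hp.2.1.trans (pow_le_pow_left₀ h0 h 2), hp.2.2⟩

theorem massProjection_massProjection_of_inter {μ μ' ρ : ℝ}
    (h : massShellRegion μ ∩ massShellRegion μ' = massShellRegion ρ) (Ψ : Fock) :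
    massProjection μ (massProjection μ' Ψ) = massProjection ρ Ψ := by
  refine momentumFunction_comp (measurable_indicator_massShellRegion μ)
    (norm_indicator_massShellRegion_le μ) (measurable_indicator_massShellRegion μ')
    (norm_indicator_massShellRegion_le μ') (measurable_indicator_massShellRegion ρ)
    (norm_indicator_massShellRegion_le ρ) (fun p => ?_) Ψ
  rw [← h]
  by_cases h1 : p ∈ massShellRegion μ <;> by_cases h2 : p ∈ massShellRegion μ' <;> simp [h1, h2]

/-- The contribution of the mass region `(0, μ]` to a vector increases with `μ`. -/
theorem monotoneOn_norm_massProjection_sub (Ψ : Fock) :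
    MonotoneOn (fun μ => ‖(massProjection μ - massProjection 0) Ψ‖) (Set.Ici 0) := by
  intro μ hμ μ' _ h
  have hμ : 0 ≤ μ := hμ
  -- `E_μ E_μ' = E_μ` and `E_μ E_0 = E_0` for `0 ≤ μ ≤ μ'`; monotonicity then follows since `E_μ` is
  -- a contraction.
  have e : (massProjection μ - massProjection 0) Ψ =
      massProjection μ ((massProjection μ' - massProjection 0) Ψ) := by
    rw [_root_.sub_apply, _root_.sub_apply, map_sub,
      massProjection_massProjection_of_inter
        (Set.inter_eq_left.mpr (massShellRegion_mono hμ h)),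
      massProjection_massProjection_of_inter
        (Set.inter_eq_right.mpr (massShellRegion_mono le_rfl hμ))]
  simp only
  rw [e]
  refine (ContinuousLinearMap.le_of_opNorm_le (c := 1) _ ?_ _).trans (one_mul _).le
  unfold massProjection spectralMeasure momentumFunction
  apply norm_diagOp_le

/-- The vacuum lives on the zero-particle level, where the total momentum is the empty sum and the
phase is `1`. -/
theorem translation_vacuum (x : Spacetime) : translation x vacuum = vacuum := by
  rw [vacuum_eq_single 0]
  ext n : 2
  apply Subtype.ext
  apply Lp.ext
  filter_upwards [momentumFunction_ae (measurable_exp_mdot x) (norm_exp_mdot_le x)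
    (lp.single 2 0 (tensorPower coneMeasure 0 0) : Fock) n,
    Lp.coeFn_zero ℂ 2 (Measure.pi fun _ : Fin n => coneMeasure)] with p h1 h0
  refine h1.trans ?_
  rcases Nat.eq_zero_or_pos n with rfl | hn
  · simp [totalMomentum, mdot]
  · rw [lp.single_apply_ne _ _ _ hn.ne']
    refine (congrArg (_ * ·) h0).trans ((mul_zero _).trans h0.symm)

/-! ### Mass bound and spectral condition for smeared operators -/

theorem smear_apply (B : Fock →L[ℂ] Fock) {χ : Spacetime → ℂ} (hχ : Integrable χ) (Ψ : Fock) :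
    smear B χ hχ Ψ = ∫ x, χ x • translation x (B (translation (-x) Ψ)) := rfl

/-- Smearing over spacetime does not spoil bounds on `E_μ - E_0`. -/
theorem norm_massProjection_sub_smear_vacuum_le (B : Fock →L[ℂ] Fock) {χ : Spacetime → ℂ}
    (hχ : Integrable χ) (μ : ℝ) :
    ‖(massProjection μ - massProjection 0) (smear B χ hχ vacuum)‖ ≤
      (∫ x, ‖χ x‖) * ‖(massProjection μ - massProjection 0) (B vacuum)‖ := by
  rw [smear_apply, ← ContinuousLinearMap.integral_comp_comm _ (integrable_smear B hχ vacuum),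
    ← integral_mul_const]
  refine norm_integral_le_of_norm_le (hχ.norm.mul_const _) (Eventually.of_forall fun x => ?_)
  rw [map_smul, norm_smul, translation_vacuum]
  refine mul_le_mul_of_nonneg_left ?_ (norm_nonneg _)
  -- Moving the projections past `U(x)` turns the vector into `U(x)(E_μ - E_0)BΩ`, whose norm is
  -- bounded independently of `x`.
  rw [_root_.sub_apply, massProjection_translation, massProjection_translation,
    ← map_sub]
  exact norm_translation_apply_le _ _

/-- The integrand is bounded by `C` on `(0, 1]`. Its measurability comes from the monotonicity of
the numerator in `μ`. -/
theorem spectralCondition_of_bound {B : Fock →L[ℂ] Fock} {C : ℝ}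
    (h : ∀ μ : ℝ, 0 ≤ μ → ‖(massProjection μ - massProjection 0) (B vacuum)‖ ≤ C * μ) :
    SpectralCondition B := by
  refine ⟨1, one_pos, ?_⟩
  have hm : AEMeasurable (fun μ => ‖(massProjection μ - massProjection 0) (B vacuum)‖)
      (volume.restrict (Set.Ioc 0 1)) :=
    aemeasurable_restrict_of_monotoneOn measurableSet_Ioc
      ((monotoneOn_norm_massProjection_sub _).mono fun x hx => hx.1.le)
  refine IntegrableOn.of_bound (C := C) (by simp) (hm.div aemeasurable_id).aestronglyMeasurable ?_
  refine (ae_restrict_iff' measurableSet_Ioc).mpr (Eventually.of_forall fun μ hμ => ?_)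
  rw [Real.norm_of_nonneg (div_nonneg (norm_nonneg _) hμ.1.le), div_le_iff₀ hμ.1]
  exact h μ hμ.1.le

/-! ### Smoothness of translations of Schwartz functions in `L¹` -/

section SchwartzTranslation
open LineDeriv
variable {E : Type*} [NormedAddCommGroup E] [NormedSpace ℝ E]

theorem exists_norm_fderiv_fderiv_le (χ : 𝓢(E, ℂ)) (k : ℕ) : ∃ C : ℝ, 0 ≤ C ∧ ∀ z : E,
    ‖fderiv ℝ (SchwartzMap.fderivCLM ℝ E ℂ χ) z‖ ≤ C * ((1 + ‖z‖) ^ k)⁻¹ := by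
  refine ⟨2 ^ k * (Finset.Iic (k, 0)).sup (fun m => SchwartzMap.seminorm ℝ m.1 m.2)
    (SchwartzMap.fderivCLM ℝ E (E →L[ℝ] ℂ) (SchwartzMap.fderivCLM ℝ E ℂ χ)), by positivity,
    fun z => ?_⟩
  have h := SchwartzMap.one_add_le_sup_seminorm_apply (𝕜 := ℝ) (m := (k, 0)) (k := k) (n := 0)
    le_rfl le_rfl (SchwartzMap.fderivCLM ℝ E (E →L[ℝ] ℂ) (SchwartzMap.fderivCLM ℝ E ℂ χ)) z
  rw [norm_iteratedFDeriv_zero, SchwartzMap.fderivCLM_apply] at h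
  rw [← div_eq_mul_inv, le_div_iff₀' (by positivity)]
  exact h

/-- A first-order Taylor estimate with rapidly decaying error. -/
theorem exists_norm_taylor_le (χ : 𝓢(E, ℂ)) (k : ℕ) : ∃ C : ℝ, 0 ≤ C ∧ ∀ h y : E, ‖h‖ ≤ 1 →
    ‖χ (y - h) - χ y + fderiv ℝ χ y h‖ ≤ C * ((1 + ‖y‖) ^ k)⁻¹ * ‖h‖ ^ 2 := by
  obtain ⟨C, hC, hb⟩ := exists_norm_fderiv_fderiv_le χ k
  -- The factor `2 ^ k` moves the decay from `z` to `y`: if `‖z - y‖ ≤ 1` then `1 + ‖y‖ ≤ 2 (1 +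
  -- ‖z‖)`.
  refine ⟨C * 2 ^ k, by positivity, fun h y hh => ?_⟩
  set K := C * 2 ^ k * ((1 + ‖y‖) ^ k)⁻¹ with hK
  have hconv := convex_closedBall y ‖h‖
  have hy : y ∈ Metric.closedBall y ‖h‖ := Metric.mem_closedBall_self (norm_nonneg h)
  have hyh : y - h ∈ Metric.closedBall y ‖h‖ := by simp [Metric.mem_closedBall]
  have hbound : ∀ z ∈ Metric.closedBall y ‖h‖,
      ‖fderiv ℝ (SchwartzMap.fderivCLM ℝ E ℂ χ) z‖ ≤ K := by
    intro z hz
    refine (hb z).trans ?_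
    rw [hK, mul_assoc]
    refine mul_le_mul_of_nonneg_left ?_ hC
    rw [← div_eq_mul_inv, le_div_iff₀ (by positivity), inv_mul_le_iff₀ (by positivity), ← mul_pow]
    refine pow_le_pow_left₀ (by positivity) ?_ k
    have h1 : ‖y‖ ≤ ‖z‖ + ‖y - z‖ := norm_le_insert' y z |>.trans (by linarith)
    have h2 : ‖y - z‖ ≤ 1 := by
      rw [norm_sub_rev]; exact (mem_closedBall_iff_norm.mp hz).trans hh
    nlinarith [norm_nonneg z]
  -- The mean value inequality is used twice: for the derivative of `χ`, then for `χ` minus its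
  -- linear part at `y`. Each use yields a factor `‖h‖`.
  have h1 : ∀ z ∈ Metric.closedBall y ‖h‖, ‖fderiv ℝ χ z - fderiv ℝ χ y‖ ≤ K * ‖h‖ := by
    intro z hz
    refine (hconv.norm_image_sub_le_of_norm_hasFDerivWithin_le
      (f := SchwartzMap.fderivCLM ℝ E ℂ χ)
      (fun w _ => ((SchwartzMap.fderivCLM ℝ E ℂ χ).hasFDerivAt w).hasFDerivWithinAt)
      hbound hy hz).trans ?_
    exact mul_le_mul_of_nonneg_left (mem_closedBall_iff_norm.mp hz) (by positivity)
  have h2 := hconv.norm_image_sub_le_of_norm_hasFDerivWithin_le' (f := χ)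
    (fun w _ => (χ.hasFDerivAt w).hasFDerivWithinAt) h1 hy hyh
  rw [sub_sub_cancel_left, map_neg, sub_neg_eq_add, norm_neg] at h2
  exact h2.trans_eq (by ring)

variable [FiniteDimensional ℝ E] [MeasurableSpace E] [BorelSpace E] (ρ : Measure E)
  [ρ.IsAddHaarMeasure]

/-- Decay of order `dim E + 1` is integrable, so the pointwise Taylor estimate passes to `L¹`. -/
theorem exists_integral_norm_taylor_le (χ : 𝓢(E, ℂ)) : ∃ C : ℝ, ∀ h : E, ‖h‖ ≤ 1 →
    ∫ y, ‖(χ.compSubConstCLM ℝ h - χ + ∂_{h} χ) y‖ ∂ρ ≤ C * ‖h‖ ^ 2 := by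
  obtain ⟨C, hC, hb⟩ := exists_norm_taylor_le χ (Module.finrank ℝ E + 1)
  have hint : Integrable (fun y : E => ((1 + ‖y‖) ^ (Module.finrank ℝ E + 1))⁻¹) ρ := by
    refine (integrable_one_add_norm (μ := ρ) (r := (Module.finrank ℝ E + 1 : ℕ))
      (by push_cast; linarith)).congr (Eventually.of_forall fun y => ?_)
    simp only
    rw [Real.rpow_neg (by positivity), Real.rpow_natCast]
  refine ⟨C * ∫ y, ((1 + ‖y‖) ^ (Module.finrank ℝ E + 1))⁻¹ ∂ρ, fun h hh => ?_⟩
  rw [← integral_const_mul, ← integral_mul_const]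
  refine integral_mono (SchwartzMap.integrable _).norm ((hint.const_mul C).mul_const _) fun y => ?_
  exact hb h y hh

variable {G : Type*} [NormedAddCommGroup G] [NormedSpace ℝ G]

/-- The derivative of `x ↦ S (χ(· - x))` for a linear map `S` on Schwartz functions. -/
def translationDeriv (S : 𝓢(E, ℂ) →ₗ[ℝ] G) (χ : 𝓢(E, ℂ)) (x : E) : E →ₗ[ℝ] G where
  toFun h := -S ((∂_{h} χ).compSubConstCLM ℝ x)
  map_add' h h' := by rw [lineDerivOp_left_add, map_add, map_add, neg_add]
  map_smul' c h := by
    rw [lineDerivOp_left_smul, map_smul, map_smul, RingHom.id_apply, smul_neg]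

/-- A linear map on Schwartz functions that is bounded in the `L¹` norm has a derivative along
translations. -/
theorem hasFDerivAt_apply_compSubConst {S : 𝓢(E, ℂ) →ₗ[ℝ] G} {M : ℝ}
    (hS : ∀ χ, ‖S χ‖ ≤ M * ∫ y, ‖χ y‖ ∂ρ) (χ : 𝓢(E, ℂ)) (x : E) :
    HasFDerivAt (fun x => S (χ.compSubConstCLM ℝ x))
      (LinearMap.toContinuousLinearMap (translationDeriv S χ x)) x := by
  rw [hasFDerivAt_iff_isLittleO_nhds_zero]
  refine Asymptotics.IsBigO.trans_isLittleO ?_ (Asymptotics.isLittleO_norm_pow_id one_lt_two)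
  obtain ⟨C, hC⟩ := exists_integral_norm_taylor_le ρ χ
  have hM : ∀ χ, ‖S χ‖ ≤ |M| * ∫ y, ‖χ y‖ ∂ρ := fun χ =>
    (hS χ).trans (mul_le_mul_of_nonneg_right (le_abs_self M) (by positivity))
  refine Asymptotics.IsBigO.of_bound (|M| * C) ?_
  filter_upwards [Metric.closedBall_mem_nhds (0 : E) one_pos] with h hh
  have hh : ‖h‖ ≤ 1 := by simpa using hh
  -- By linearity and the group law, the remainder at `x` is `S` of the remainder at the origin
  -- translated by `x`; translation does not change its `L¹` norm.
  have e : S (χ.compSubConstCLM ℝ (x + h)) - S (χ.compSubConstCLM ℝ x) -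
      -S ((∂_{h} χ).compSubConstCLM ℝ x) =
      S ((χ.compSubConstCLM ℝ h - χ + ∂_{h} χ).compSubConstCLM ℝ x) := by
    rw [map_add, map_sub, map_add, map_sub, SchwartzMap.compSubConstCLM_comp, add_comm h x]
    abel
  change ‖S (χ.compSubConstCLM ℝ (x + h)) - S (χ.compSubConstCLM ℝ x) -
      -S ((∂_{h} χ).compSubConstCLM ℝ x)‖ ≤ _
  rw [e, norm_pow, norm_norm, mul_assoc]
  refine (hM _).trans (mul_le_mul_of_nonneg_left ((le_of_eq ?_).trans (hC h hh)) (abs_nonneg M))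
  exact integral_sub_right_eq_self (μ := ρ) (fun y => ‖(χ.compSubConstCLM ℝ h - χ + ∂_{h} χ) y‖) x

/-- Induction on the order, for all `χ` at once: the derivative in direction `h` is minus the same
expression for the Schwartz function `∂_{h} χ`. Directional derivatives suffice because `E` is
finite-dimensional. -/
theorem contDiff_apply_compSubConst {S : 𝓢(E, ℂ) →ₗ[ℝ] G} {M : ℝ}
    (hS : ∀ χ, ‖S χ‖ ≤ M * ∫ y, ‖χ y‖ ∂ρ) (χ : 𝓢(E, ℂ)) :
    ContDiff ℝ ∞ fun x => S (χ.compSubConstCLM ℝ x) := by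
  have hd := fun χ x => hasFDerivAt_apply_compSubConst ρ hS χ x
  rw [contDiff_infty]
  intro n
  induction n generalizing χ with
  | zero => exact contDiff_zero.mpr (continuous_iff_continuousAt.mpr fun x => (hd χ x).continuousAt)
  | succ n ih =>
    push_cast
    rw [contDiff_succ_iff_fderiv_apply]
    refine ⟨fun x => (hd χ x).differentiableAt, fun h => ?_, fun h => ?_⟩
    -- The analyticity clause concerns only order `ω`, while `n` is a natural number.
    · exact absurd h (by simp)
    · simp only [(hd χ _).fderiv]
      exact (ih (∂_{h} χ)).neg

end SchwartzTranslation

/-! ### Smoothness of smeared operators -/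

theorem norm_smear_le (B : Fock →L[ℂ] Fock) {χ : Spacetime → ℂ} (hχ : Integrable χ) :
    ‖smear B χ hχ‖ ≤ (∫ x, ‖χ x‖) * ‖B‖ :=
  LinearMap.mkContinuous_norm_le _ (by positivity) _

/-- Smearing as a linear function of the test function. -/
def smearLinear (B : Fock →L[ℂ] Fock) : 𝓢(Spacetime, ℂ) →ₗ[ℝ] Fock →L[ℂ] Fock where
  toFun χ := smear B χ χ.integrable
  map_add' χ χ' := by
    ext1 Ψ
    simp only [smear_apply, _root_.add_apply, add_smul]
    exact integral_add (integrable_smear B χ.integrable Ψ) (integrable_smear B χ'.integrable Ψ)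
  map_smul' c χ := by
    ext1 Ψ
    simp only [smear_apply, _root_.smul_apply, smul_assoc, RingHom.id_apply]
    exact integral_smul c _

/-- The group law of `U` and the substitution `y ↦ y - x` in the smearing integral transfer the
conjugation to the test function. -/
theorem translation_smear_translation (B : Fock →L[ℂ] Fock) (χ : 𝓢(Spacetime, ℂ)) (x : Spacetime) :
    translation x ∘L smear B χ χ.integrable ∘L translation (-x) =
      smearLinear B (χ.compSubConstCLM ℝ x) := by
  ext1 Ψ
  change translation x (smear B χ χ.integrable (translation (-x) Ψ)) =
    smear B (χ.compSubConstCLM ℝ x) (χ.compSubConstCLM ℝ x).integrable Ψ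
  rw [smear_apply, smear_apply, ← ContinuousLinearMap.integral_comp_comm _ (integrable_smear B χ.integrable _),
    ← integral_sub_right_eq_self _ x]
  refine integral_congr_ae (Eventually.of_forall fun y => ?_)
  simp only [map_smul, translation_translation, SchwartzMap.compSubConstCLM_apply]
  congr 3
  · abel
  · congr 2; abel

/-- Smearing is bounded by `‖B‖` times the `L¹` norm of the test function, so the translation
calculus applies in operator norm. No property of `B` beyond boundedness enters. -/
theorem isSmooth_smear (B : Fock →L[ℂ] Fock) (χ : 𝓢(Spacetime, ℂ)) :
    IsSmooth (smear B χ χ.integrable) := by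
  unfold IsSmooth
  simp only [translation_smear_translation]
  exact contDiff_apply_compSubConst volume (M := ‖B‖)
    (fun χ => (norm_smear_le B χ.integrable).trans_eq (mul_comm _ _)) χ

end FreeField
end

theorem mainTheorem11 (J : 𝓢(FreeField.Spacetime, ℂ)) :
    (∃ C : ℝ, ∀ μ : ℝ, 0 ≤ μ →
      ‖(FreeField.massProjection μ - FreeField.massProjection 0)
        (FreeField.weyl J FreeField.vacuum)‖ ≤ C * μ) ∧
    ∀ χ : 𝓢(FreeField.Spacetime, ℂ),
      FreeField.IsSmooth (FreeField.smear (FreeField.weyl J) χ χ.integrable) ∧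
      (∃ C : ℝ, ∀ μ : ℝ, 0 ≤ μ →
        ‖(FreeField.massProjection μ - FreeField.massProjection 0)
          (FreeField.smear (FreeField.weyl J) χ χ.integrable FreeField.vacuum)‖ ≤ C * μ) ∧
      FreeField.SpectralCondition (FreeField.smear (FreeField.weyl J) χ χ.integrable) := by
  obtain ⟨C, hC⟩ := FreeField.exists_norm_massProjection_sub_weyl_vacuum_le J
  refine ⟨⟨C, hC⟩, fun χ => ?_⟩
  have h : ∀ μ : ℝ, 0 ≤ μ → ‖(FreeField.massProjection μ - FreeField.massProjection 0)
      (FreeField.smear (FreeField.weyl J) χ χ.integrable FreeField.vacuum)‖ ≤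
        (∫ x, ‖χ x‖) * C * μ := fun μ hμ => by
    refine (FreeField.norm_massProjection_sub_smear_vacuum_le _ χ.integrable μ).trans ?_
    rw [mul_assoc]
    exact mul_le_mul_of_nonneg_left (hC μ hμ) (by positivity)
  exact ⟨FreeField.isSmooth_smear _ χ, ⟨_, h⟩, FreeField.spectralCondition_of_bound h⟩
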